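/- Conventions. Let $P$ be a set. A groupoid with base $P$ is a groupoid $\mathcal G$ with set of objects $P$; we also write $\mathcal G$ for its set of arrows, composition is written $fg$ when the end of $f$ is the source of $g$, and $\mathcal G^{op}$ denotes the opposite groupoid. Morphisms of groupoids over $P$ are functors that are the identity on $P$. A left action of $\mathcal G$ on a map $p:E\to P$ assigns to each pair $(g,e)$ with $\mathrm{end}(g)=p(e)$ an element $g\triangleright e\in E$ with $p(g\triangleright e)=\mathrm{source}(g)$, $g\triangleright(h\triangleright e)=gh\triangleright e$ and $\mathrm{id}_{p(e)}\triangleright e=e$; right actions are defined symmetrically. A matched pair of groupoids $(V,H)$ with base $P$ consists of groupoids $V$ (source $t$, end $b$) and $H$ (source $l$, end $r$) with base $P$, a left action $\triangleright$ of $H$ on $t:V\to P$ and a right action $\triangleleft$ of $V$ on $r:H\to P$ such that $b(x\triangleright g)=l(x\triangleleft g)$, $x\triangleright fg=(x\triangleright f)((x\triangleleft f)\triangleright g)$ and $xy\triangleleft g=(x\triangleleft(y\triangleright g))(y\triangleleft g)$ whenever the operations are defined. A morphism of matched pairs $(\alpha,\beta):(\mathbb V,\mathbb H)\to(V,H)$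 with base $P$ is a pair of morphisms of groupoids over $P$, $\alpha:\mathbb H\to H$ and $\beta:V\to\mathbb V$, with $\beta(\alpha(h)\triangleright g)=h\triangleright\beta(g)$ and $\alpha(h\triangleleft\beta(g))=\alpha(h)\triangleleft g$ whenever $r(h)=t(g)$. A quiver over $P$ is a set $E$ with two maps $p,q:E\to P$; these form a category $\mathrm{Quiv}(P)$. A representation of $(V,H)$ is a quiver $(E,p,q)$ with a left action of $H$ on $p$ and a grading $E\to V$, $e\mapsto|e|$, such that $p(e)=t(|e|)$, $q(e)=b(|e|)$ and $|x\triangleright e|=x\triangleright|e|$; morphisms are the maps that intertwine the actions and preserve the gradings. The category $\mathrm{Rep}(V,H)$ is monoidal with $E\otimes F=\{(e,f):q(e)=p(f)\}$, $p(e,f)=p(e)$, $q(e,f)=q(f)$, $x\triangleright(e,f)=(x\triangleright e,(x\triangleleft|e|)\triangleright f)$, $|(e,f)|=|e||f|$, and unit object $P$ with $p=q=\mathrm{id}$, $x\triangleright r(x)=l(x)$, $|a|=\mathrm{id}_V a$; the evident identifications $(E\otimes F)\otimes K\cong E\otimes(F\otimes K)$, $P\otimes E\cong E\cong E\otimes P$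 are treated as identities. Let $f\ell$ be the functor to $\mathrm{Quiv}(P)$ forgetting action and grading. The restriction functor $\mathrm{Res}^\beta_\alpha:\mathrm{Rep}(V,H)\to\mathrm{Rep}(\mathbb V,\mathbb H)$ keeps the quiver and the morphisms and has $h\triangleright e=\alpha(h)\triangleright e$, $\|e\|=\beta(|e|)$; it is strict monoidal. The generalized double $D(\alpha,\beta)=(\mathbb V\times_P H^{op},\,V\bowtie\mathbb H)$ is the following matched pair with base $P$. The groupoid $\mathbb V\times_P H^{op}$ (the restricted product) has as arrows the pairs $(\gamma,x)\in\mathbb V\times H$ with $t(\gamma)=r(x)$ and $b(\gamma)=l(x)$, with source $t(\gamma)$, end $b(\gamma)$ and product $(\gamma,x)(\gamma',x')=(\gamma\gamma',x'x)$. The groupoid $V\bowtie\mathbb H$ has as arrows the pairs $(g,h)\in V\times\mathbb H$ with $b(g)=l(h)$, with source $t(g)$, end $r(h)$ and product $(f,u)(g,h)=(f(\alpha(u)\triangleright g),(u\triangleleft\beta(g))h)$. With $\Omega=\alpha(h\triangleleft\gamma)\,x\,\alpha(h)^{-1}$, the actions are $(g,h)\rightharpoonup(\gamma,x)=\bigl(\beta(g)(h\triangleright\gamma)\beta(\Omega\triangleright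 g^{-1}),\ \Omega\triangleleft g^{-1}\bigr)$ and $(g,h)\leftharpoonup(\gamma,x)=\bigl((\Omega\triangleleft g^{-1})\triangleright g,\ h\triangleleft\gamma\bigr)$ for $r(h)=t(\gamma)$. For a monoidal functor $F:\mathcal C\to\mathcal D$, the centralizer $Z(F)$ is the monoidal category whose objects are pairs $(D,\zeta)$ of an object $D$ of $\mathcal D$ and a natural isomorphism $\zeta_X:F(X)\otimes D\to D\otimes F(X)$ with $\zeta_{X\otimes Y}=(\zeta_X\otimes\mathrm{id})(\mathrm{id}\otimes\zeta_Y)$ and $\zeta_{\mathbf 1}=\mathrm{id}_D$ (up to the structure isomorphisms of $F$ and of the monoidal categories), whose morphisms $(D,\zeta)\to(E,\vartheta)$ are the $f:D\to E$ with $\vartheta_X(\mathrm{id}\otimes f)=(f\otimes\mathrm{id})\zeta_X$ for all $X$, with $(D,\zeta)\otimes(E,\vartheta)=(D\otimes E,(\mathrm{id}\otimes\vartheta)(\zeta\otimes\mathrm{id}))$, the tensor product of morphisms of $\mathcal D$, and unit object $(\mathbf 1,\mathrm{id})$. Let $U:Z(F)\to\mathcal D$, $U(D,\zeta)=D$. Theorem.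 Let $(\alpha,\beta):(\mathbb V,\mathbb H)\to(V,H)$ be a morphism of matched pairs of groupoids with base $P$. There is a strict monoidal equivalence $$\mathrm{Rep}\,D(\alpha,\beta)\;\cong\;Z(\mathrm{Res}^\beta_\alpha)$$ (an equivalence of monoidal categories in which both functors preserve unit objects and tensor products strictly), and its composite with $U:Z(\mathrm{Res}^\beta_\alpha)\to\mathrm{Rep}(\mathbb V,\mathbb H)$ and $f\ell:\mathrm{Rep}(\mathbb V,\mathbb H)\to\mathrm{Quiv}(P)$ equals $f\ell:\mathrm{Rep}\,D(\alpha,\beta)\to\mathrm{Quiv}(P)$. -/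

import Mathlib

set_option linter.unusedVariables false

universe u v₁ v₂ u₁ u₂

open CategoryTheory MonoidalCategory

namespace MatchedPairs

/-! ### Groupoids over a fixed base -/

/-- A groupoid with base `P`, presented by its set of arrows, source and end maps, identities,
inverses, and a composition `comp f g = fg` (first `f`, then `g`) defined when the end of `f` is the
source of `g`. -/
structure GroupoidOver (P : Type u) where
  Arr : Type u
  src : Arr → P
  tgt : Arr → P
  one : P → Arr
  comp : ∀ f g : Arr, tgt f = src g → Arr
  inv : Arr → Arr
  src_one : ∀ p, src (one p) = p
  tgt_one : ∀ p, tgt (one p) = p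
  src_comp : ∀ f g h, src (comp f g h) = src f
  tgt_comp : ∀ f g h, tgt (comp f g h) = tgt g
  src_inv : ∀ f, src (inv f) = tgt f
  tgt_inv : ∀ f, tgt (inv f) = src f
  one_comp : ∀ f, comp (one (src f)) f (tgt_one _) = f
  comp_one : ∀ f, comp f (one (tgt f)) (src_one _).symm = f
  assoc : ∀ f g k (h₁ : tgt f = src g) (h₂ : tgt g = src k),
    comp (comp f g h₁) k ((tgt_comp _ _ _).trans h₂) =
      comp f (comp g k h₂) (h₁.trans (src_comp _ _ _).symm)
  inv_comp : ∀ f, comp (inv f) f (tgt_inv f) = one (tgt f)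
  comp_inv : ∀ f, comp f (inv f) (src_inv f).symm = one (src f)

namespace GroupoidOver

variable {P : Type u} (G : GroupoidOver P)

theorem comp_congr {f f' g g' : G.Arr} (hf : f = f') (hg : g = g') (h : G.tgt f = G.src g) :
    G.comp f g h = G.comp f' g' (hf ▸ hg ▸ h) := by
  subst hf hg; rfl

theorem one_comp' {p : P} (f : G.Arr) (h : G.tgt (G.one p) = G.src f) :
    G.comp (G.one p) f h = f := by
  have hp : p = G.src f := (G.tgt_one p).symm.trans h
  subst hp; exact G.one_comp f

theorem comp_one' {p : P} (f : G.Arr) (h : G.tgt f = G.src (G.one p)) :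
    G.comp f (G.one p) h = f := by
  have hp : p = G.tgt f := (G.src_one p).symm.trans h.symm
  subst hp; exact G.comp_one f

theorem assoc' (f g k : G.Arr) (h₁ : G.tgt f = G.src g) (h₂ : G.tgt (G.comp f g h₁) = G.src k) :
    G.comp (G.comp f g h₁) k h₂ =
      G.comp f (G.comp g k ((G.tgt_comp _ _ _).symm.trans h₂))
        (h₁.trans (G.src_comp _ _ _).symm) :=
  G.assoc f g k h₁ _

theorem inv_comp_cancel (f g : G.Arr) (h : G.tgt f = G.src g)
    (h' : G.tgt (G.inv f) = G.src (G.comp f g h)) : G.comp (G.inv f) (G.comp f g h) h' = g := by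
  rw [← G.assoc (G.inv f) f g (G.tgt_inv f) h, G.comp_congr (G.inv_comp f) rfl, G.one_comp']

theorem comp_inv_cancel (f g : G.Arr) (h : G.tgt (G.inv f) = G.src g)
    (h' : G.tgt f = G.src (G.comp (G.inv f) g h)) : G.comp f (G.comp (G.inv f) g h) h' = g := by
  rw [← G.assoc f (G.inv f) g (G.src_inv f).symm h, G.comp_congr (G.comp_inv f) rfl, G.one_comp']

theorem comp_left_cancel {f g g' : G.Arr} {h : G.tgt f = G.src g} {h' : G.tgt f = G.src g'}
    (e : G.comp f g h = G.comp f g' h') : g = g' := by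
  rw [← G.inv_comp_cancel f g h (by rw [G.tgt_inv, G.src_comp]),
    ← G.inv_comp_cancel f g' h' (by rw [G.tgt_inv, G.src_comp])]
  exact G.comp_congr rfl e _

theorem comp_right_cancel {f f' g : G.Arr} {h : G.tgt f = G.src g} {h' : G.tgt f' = G.src g}
    (e : G.comp f g h = G.comp f' g h') : f = f' := by
  have key : ∀ (a : G.Arr) (ha : G.tgt a = G.src g),
      G.comp (G.comp a g ha) (G.inv g) (by rw [G.tgt_comp, G.src_inv]) = a := fun a ha => by
    rw [G.assoc', G.comp_congr rfl (G.comp_inv g), G.comp_one']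
  rw [← key f h, ← key f' h']
  exact G.comp_congr e rfl _

/-- Pasting of two commutative squares along a common edge. -/
theorem paste {a₁ a₂ b₁ b₂ v w₁ w₂ : G.Arr} {h₁ : G.tgt a₁ = G.src w₂} {h₂ : G.tgt w₁ = G.src b₁}
    {h₃ : G.tgt a₂ = G.src v} {h₄ : G.tgt w₂ = G.src b₂}
    (e₁ : G.comp a₁ w₂ h₁ = G.comp w₁ b₁ h₂) (e₂ : G.comp a₂ v h₃ = G.comp w₂ b₂ h₄)
    (ha : G.tgt a₁ = G.src a₂) (hb : G.tgt b₁ = G.src b₂) :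
    G.comp (G.comp a₁ a₂ ha) v ((G.tgt_comp _ _ _).trans h₃) =
      G.comp w₁ (G.comp b₁ b₂ hb) (h₂.trans (G.src_comp _ _ _).symm) := by
  rw [G.assoc', G.comp_congr rfl e₂, ← G.assoc a₁ w₂ b₂ h₁ h₄, G.comp_congr e₁ rfl, G.assoc']

/-- The opposite groupoid. -/
abbrev op : GroupoidOver P where
  Arr := G.Arr
  src := G.tgt
  tgt := G.src
  one := G.one
  comp f g h := G.comp g f h.symm
  inv := G.inv
  src_one := G.tgt_one
  tgt_one := G.src_one
  src_comp _ _ _ := G.tgt_comp _ _ _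
  tgt_comp _ _ _ := G.src_comp _ _ _
  src_inv := G.tgt_inv
  tgt_inv := G.src_inv
  one_comp := G.comp_one
  comp_one := G.one_comp
  assoc f g k h₁ h₂ := (G.assoc k g f h₂.symm h₁.symm).symm
  inv_comp := G.comp_inv
  comp_inv := G.inv_comp

/-- The restricted product of two groupoids over `P`: pairs of arrows with the same source and the
same end, with componentwise composition. -/
abbrev rprod (K : GroupoidOver P) : GroupoidOver P where
  Arr := {a : G.Arr × K.Arr // G.src a.1 = K.src a.2 ∧ G.tgt a.1 = K.tgt a.2}
  src a := G.src a.1.1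
  tgt a := G.tgt a.1.1
  one p := ⟨(G.one p, K.one p), by simp only [src_one], by simp only [tgt_one]⟩
  comp a b h := ⟨(G.comp a.1.1 b.1.1 h, K.comp a.1.2 b.1.2 (a.2.2.symm.trans (h.trans b.2.1))),
    by simpa only [src_comp] using a.2.1, by simpa only [tgt_comp] using b.2.2⟩
  inv a := ⟨(G.inv a.1.1, K.inv a.1.2), by simpa only [src_inv] using a.2.2,
    by simpa only [tgt_inv] using a.2.1⟩
  src_one p := G.src_one p
  tgt_one p := G.tgt_one p
  src_comp _ _ _ := G.src_comp _ _ _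
  tgt_comp _ _ _ := G.tgt_comp _ _ _
  src_inv _ := G.src_inv _
  tgt_inv _ := G.tgt_inv _
  one_comp a := Subtype.ext (Prod.ext (G.one_comp' _ _) (K.one_comp' _ _))
  comp_one a := Subtype.ext (Prod.ext (G.comp_one' _ _) (K.comp_one' _ _))
  assoc a b c h₁ h₂ := Subtype.ext (Prod.ext (G.assoc' _ _ _ _ _) (K.assoc' _ _ _ _ _))
  inv_comp a := Subtype.ext (Prod.ext (G.inv_comp _)
    ((K.inv_comp _).trans (congrArg K.one a.2.2.symm)))
  comp_inv a := Subtype.ext (Prod.ext (G.comp_inv _)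
    ((K.comp_inv _).trans (congrArg K.one a.2.1.symm)))

/-- A morphism of groupoids over `P`: a functor that is the identity on `P`. -/
structure Hom (G K : GroupoidOver P) where
  toFun : G.Arr → K.Arr
  src_map : ∀ f, K.src (toFun f) = G.src f
  tgt_map : ∀ f, K.tgt (toFun f) = G.tgt f
  map_one : ∀ p, toFun (G.one p) = K.one p
  map_comp : ∀ f g (h : G.tgt f = G.src g), toFun (G.comp f g h) =
    K.comp (toFun f) (toFun g) ((tgt_map f).trans (h.trans (src_map g).symm))

end GroupoidOver

/-! ### Actions and matched pairs -/

/-- A left action of the groupoid `G` on a map `p : E → P`. -/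
structure LeftAction {P : Type u} (G : GroupoidOver P) {E : Type u} (p : E → P) where
  act : ∀ (g : G.Arr) (e : E), G.tgt g = p e → E
  p_act : ∀ g e h, p (act g e h) = G.src g
  act_act : ∀ g k e (h₁ : G.tgt g = G.src k) (h₂ : G.tgt k = p e),
    act g (act k e h₂) (h₁.trans (p_act _ _ _).symm) =
      act (G.comp g k h₁) e ((G.tgt_comp _ _ _).trans h₂)
  one_act : ∀ e, act (G.one (p e)) e (G.tgt_one _) = e

/-- A right action of the groupoid `G` on a map `q : E → P`. -/
structure RightAction {P : Type u} (G : GroupoidOver P) {E : Type u} (q : E → P) where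
  act : ∀ (e : E) (g : G.Arr), q e = G.src g → E
  q_act : ∀ e g h, q (act e g h) = G.tgt g
  act_act : ∀ e g k (h₁ : q e = G.src g) (h₂ : G.tgt g = G.src k),
    act (act e g h₁) k ((q_act _ _ _).trans h₂) =
      act e (G.comp g k h₂) (h₁.trans (G.src_comp _ _ _).symm)
  act_one : ∀ e, act e (G.one (q e)) (G.src_one _).symm = e

namespace LeftAction

variable {P : Type u} {G : GroupoidOver P} {E : Type u} {p : E → P} (a : LeftAction G p)

theorem congr {g g' : G.Arr} {e e' : E} (hg : g = g') (he : e = e') (h : G.tgt g = p e) :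
    a.act g e h = a.act g' e' (hg ▸ he ▸ h) := by
  subst hg he; rfl

theorem one_act' {r : P} (e : E) (h : G.tgt (G.one r) = p e) : a.act (G.one r) e h = e := by
  have hp : r = p e := (G.tgt_one r).symm.trans h
  subst hp; exact a.one_act e

end LeftAction

namespace RightAction

variable {P : Type u} {G : GroupoidOver P} {E : Type u} {q : E → P} (a : RightAction G q)

theorem congr {g g' : G.Arr} {e e' : E} (he : e = e') (hg : g = g') (h : q e = G.src g) :
    a.act e g h = a.act e' g' (hg ▸ he ▸ h) := by
  subst hg he; rfl

theorem act_one' {r : P} (e : E) (h : q e = G.src (G.one r)) : a.act e (G.one r) h = e := by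
  have hp : r = q e := (G.src_one r).symm.trans h.symm
  subst hp; exact a.act_one e

end RightAction

/-- A matched pair of groupoids `(V, H)` with base `P`. The maps `t, b` are `V.src, V.tgt`, the maps
`l, r` are `H.src, H.tgt`; `left.act x g` is `x ▷ g` and `right.act x g` is `x ◁ g`. -/
structure MatchedPair (P : Type u) where
  V : GroupoidOver P
  H : GroupoidOver P
  left : LeftAction H V.src
  right : RightAction V H.tgt
  tgt_left : ∀ x g h, V.tgt (left.act x g h) = H.src (right.act x g h)
  left_comp : ∀ x f g (h₁ : H.tgt x = V.src f) (h₂ : V.tgt f = V.src g),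
    left.act x (V.comp f g h₂) (h₁.trans (V.src_comp _ _ _).symm) =
      V.comp (left.act x f h₁) (left.act (right.act x f h₁) g ((right.q_act _ _ _).trans h₂))
        ((tgt_left _ _ _).trans (left.p_act _ _ _).symm)
  comp_right : ∀ x y g (h₁ : H.tgt x = H.src y) (h₂ : H.tgt y = V.src g),
    right.act (H.comp x y h₁) g ((H.tgt_comp _ _ _).trans h₂) =
      H.comp (right.act x (left.act y g h₂) (h₁.trans (left.p_act _ _ _).symm))
        (right.act y g h₂) ((right.q_act _ _ _).trans (tgt_left _ _ _))

namespace MatchedPair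

variable {P : Type u} (M : MatchedPair P)

theorem left_one' {p : P} (x : M.H.Arr) (h : M.H.tgt x = M.V.src (M.V.one p)) :
    M.left.act x (M.V.one p) h = M.V.one (M.H.src x) := by
  have hp : p = M.H.tgt x := (M.V.src_one p).symm.trans h.symm
  subst hp
  have e := M.left_comp x (M.V.one (M.H.tgt x)) (M.V.one (M.H.tgt x)) h
    ((M.V.tgt_one _).trans (M.V.src_one _).symm)
  have e₁ := M.left.congr (rfl : x = x)
    (M.V.one_comp' (M.V.one (M.H.tgt x)) ((M.V.tgt_one _).trans (M.V.src_one _).symm))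
    (h.trans (M.V.src_comp _ _ _).symm)
  have e₂ := M.left.congr (M.right.act_one' x h) (rfl : M.V.one (M.H.tgt x) = _)
    ((M.right.q_act _ _ _).trans ((M.V.tgt_one _).trans (M.V.src_one _).symm))
  rw [e₁, M.V.comp_congr rfl e₂] at e
  have e₃ := (M.V.comp_one _).trans e
  rw [← M.V.comp_left_cancel e₃, M.tgt_left, M.right.act_one']

theorem one_right' {p : P} (g : M.V.Arr) (h : M.H.tgt (M.H.one p) = M.V.src g) :
    M.right.act (M.H.one p) g h = M.H.one (M.V.tgt g) := by
  have hp : p = M.V.src g := (M.H.tgt_one p).symm.trans h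
  subst hp
  have e := M.comp_right (M.H.one (M.V.src g)) (M.H.one (M.V.src g)) g
    ((M.H.tgt_one _).trans (M.H.src_one _).symm) h
  have e₁ := M.right.congr
    (M.H.one_comp' (M.H.one (M.V.src g)) ((M.H.tgt_one _).trans (M.H.src_one _).symm))
    (rfl : g = g) ((M.H.tgt_comp _ _ _).trans h)
  have e₂ := M.right.congr (rfl : M.H.one (M.V.src g) = _) (M.left.one_act' g h)
    (((M.H.tgt_one _).trans (M.H.src_one _).symm).trans (M.left.p_act _ _ _).symm)
  rw [e₁, M.H.comp_congr e₂ rfl] at e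
  have e₃ := (M.H.one_comp _).trans e
  rw [← M.H.comp_right_cancel e₃, ← M.tgt_left, M.left.one_act']

/-- The diagonal groupoid `V ⋈ H`. -/
abbrev diag : GroupoidOver P where
  Arr := {a : M.V.Arr × M.H.Arr // M.V.tgt a.1 = M.H.src a.2}
  src a := M.V.src a.1.1
  tgt a := M.H.tgt a.1.2
  one p := ⟨(M.V.one p, M.H.one p), by rw [M.V.tgt_one, M.H.src_one]⟩
  comp a b h :=
    ⟨(M.V.comp a.1.1 (M.left.act a.1.2 b.1.1 h) (a.2.trans (M.left.p_act _ _ _).symm),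
      M.H.comp (M.right.act a.1.2 b.1.1 h) b.1.2 ((M.right.q_act _ _ _).trans b.2)),
      by rw [M.V.tgt_comp, M.H.src_comp, M.tgt_left]⟩
  inv a :=
    ⟨(M.left.act (M.H.inv a.1.2) (M.V.inv a.1.1)
        ((M.H.tgt_inv _).trans (a.2.symm.trans (M.V.src_inv _).symm)),
      M.right.act (M.H.inv a.1.2) (M.V.inv a.1.1)
        ((M.H.tgt_inv _).trans (a.2.symm.trans (M.V.src_inv _).symm))),
      M.tgt_left _ _ _⟩
  src_one p := M.V.src_one p
  tgt_one p := M.H.tgt_one p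
  src_comp _ _ _ := M.V.src_comp _ _ _
  tgt_comp _ _ _ := M.H.tgt_comp _ _ _
  src_inv _ := (M.left.p_act _ _ _).trans (M.H.src_inv _)
  tgt_inv _ := (M.right.q_act _ _ _).trans (M.V.tgt_inv _)
  one_comp a := Subtype.ext (Prod.ext
    ((M.V.comp_congr rfl (M.left.one_act' _ _) _).trans (M.V.one_comp' _ _))
    ((M.H.comp_congr (M.one_right' _ _) rfl _).trans (M.H.one_comp' _ _)))
  comp_one a := Subtype.ext (Prod.ext
    ((M.V.comp_congr rfl (M.left_one' _ _) _).trans (M.V.comp_one' _ _))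
    ((M.H.comp_congr (M.right.act_one' _ _) rfl _).trans (M.H.comp_one' _ _)))
  assoc a b c h₁ h₂ := by
    obtain ⟨⟨f, x⟩, ha⟩ := a
    obtain ⟨⟨g, y⟩, hb⟩ := b
    obtain ⟨⟨k, z⟩, hc⟩ := c
    dsimp only at ha hb hc h₁ h₂
    refine Subtype.ext (Prod.ext ?_ ?_)
    · dsimp only
      rw [M.V.assoc']
      refine M.V.comp_congr rfl ?_ _
      rw [M.left_comp x g _ h₁ (hb.trans (M.left.p_act _ _ _).symm)]
      refine M.V.comp_congr rfl ?_ _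
      rw [M.left.act_act]
    · dsimp only
      rw [← M.H.assoc _ _ z (((M.right.q_act _ _ _).trans
        ((M.V.tgt_comp _ _ _).trans (M.tgt_left _ _ _)))) ((M.right.q_act _ _ _).trans hc)]
      refine M.H.comp_congr ?_ rfl _
      rw [M.comp_right _ _ _ ((M.right.q_act _ _ _).trans hb) h₂]
      refine M.H.comp_congr ?_ rfl _
      rw [M.right.act_act]
  inv_comp a := by
    obtain ⟨⟨f, x⟩, ha⟩ := a
    dsimp only at ha
    refine Subtype.ext (Prod.ext ?_ ?_)
    · dsimp only
      rw [← M.left_comp (M.H.inv x) (M.V.inv f) f _ (M.V.tgt_inv f),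
        M.left.congr rfl (M.V.inv_comp f), M.left_one', M.H.src_inv]
    · dsimp only
      rw [M.H.comp_congr (M.right.act_act (M.H.inv x) (M.V.inv f) f _ (M.V.tgt_inv f)) rfl,
        M.H.comp_congr (M.right.congr rfl (M.V.inv_comp f) _) rfl,
        M.H.comp_congr (M.right.act_one' _ _) rfl, M.H.inv_comp]
  comp_inv a := by
    obtain ⟨⟨f, x⟩, ha⟩ := a
    dsimp only at ha
    refine Subtype.ext (Prod.ext ?_ ?_)
    · dsimp only
      rw [M.V.comp_congr rfl (M.left.act_act x (M.H.inv x) (M.V.inv f) (M.H.src_inv x).symm _),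
        M.V.comp_congr rfl (M.left.congr (M.H.comp_inv x) rfl _),
        M.V.comp_congr rfl (M.left.one_act' _ _), M.V.comp_inv]
    · dsimp only
      rw [← M.comp_right x (M.H.inv x) (M.V.inv f) (M.H.src_inv x).symm _,
        M.right.congr (M.H.comp_inv x) rfl, M.one_right', M.V.tgt_inv]

/-- A morphism of matched pairs `(𝕍, ℍ) ⟶ (V, H)`, where `(𝕍, ℍ) = M` and `(V, H) = N`: a pair of
morphisms of groupoids over `P`, `α : ℍ ⟶ H` and `β : V ⟶ 𝕍`, compatible with the actions. -/
structure Hom (M N : MatchedPair P) where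
  α : GroupoidOver.Hom M.H N.H
  β : GroupoidOver.Hom N.V M.V
  map_left : ∀ (h : M.H.Arr) (g : N.V.Arr) (e : M.H.tgt h = N.V.src g),
    β.toFun (N.left.act (α.toFun h) g ((α.tgt_map h).trans e)) =
      M.left.act h (β.toFun g) (e.trans (β.src_map g).symm)
  map_right : ∀ (h : M.H.Arr) (g : N.V.Arr) (e : M.H.tgt h = N.V.src g),
    α.toFun (M.right.act h (β.toFun g) (e.trans (β.src_map g).symm)) =
      N.right.act (α.toFun h) g ((α.tgt_map h).trans e)

namespace Hom

variable {P : Type u} {M N : MatchedPair P} (φ : Hom M N)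

theorem αcongr {h h' : M.H.Arr} (e : h = h') : φ.α.toFun h = φ.α.toFun h' := congrArg _ e

theorem βcongr {g g' : N.V.Arr} (e : g = g') : φ.β.toFun g = φ.β.toFun g' := congrArg _ e

/-- The matched pair `(V, ℍ)` with actions `h ⇀ g = α(h) ▷ g` and `h ↼ g = h ◁ β(g)`. -/
abbrev mixed : MatchedPair P where
  V := N.V
  H := M.H
  left :=
    { act := fun h g e => N.left.act (φ.α.toFun h) g ((φ.α.tgt_map h).trans e)
      p_act := fun _ _ _ => (N.left.p_act _ _ _).trans (φ.α.src_map _)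
      act_act := fun g k e h₁ h₂ => by
        rw [N.left.act_act _ _ _ ((φ.α.tgt_map g).trans (h₁.trans (φ.α.src_map k).symm))]
        exact N.left.congr (φ.α.map_comp _ _ _).symm rfl _
      one_act := fun e => by
        rw [N.left.congr (φ.α.map_one _) rfl, N.left.one_act'] }
  right :=
    { act := fun h g e => M.right.act h (φ.β.toFun g) (e.trans (φ.β.src_map g).symm)
      q_act := fun _ _ _ => (M.right.q_act _ _ _).trans (φ.β.tgt_map _)
      act_act := fun e g k h₁ h₂ => by
        rw [M.right.act_act _ _ _ _ ((φ.β.tgt_map g).trans (h₂.trans (φ.β.src_map k).symm))]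
        exact M.right.congr rfl (φ.β.map_comp _ _ _).symm _
      act_one := fun e => by
        rw [M.right.congr rfl (φ.β.map_one _), M.right.act_one'] }
  tgt_left h g e := by
    rw [N.tgt_left, ← φ.map_right h g e, φ.α.src_map]
  left_comp h f g h₁ h₂ := by
    rw [N.left_comp _ f g ((φ.α.tgt_map h).trans h₁) h₂]
    exact N.V.comp_congr rfl (N.left.congr (φ.map_right h f h₁).symm rfl _) _
  comp_right x y g h₁ h₂ := by
    rw [M.comp_right x y _ h₁ (h₂.trans (φ.β.src_map g).symm)]
    exact M.H.comp_congr (M.right.congr rfl (φ.map_left y g h₂).symm _) rfl _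

/-- The horizontal groupoid `V ⋈ ℍ` of the generalized double. -/
abbrev dH : GroupoidOver P := φ.mixed.diag

/-- The vertical groupoid of the generalized double: the restricted product of `𝕍` and `Hᵒᵖ`. -/
abbrev dV (_ : Hom M N) : GroupoidOver P := M.V.rprod N.H.op

section formulas

variable (g : N.V.Arr) (h : M.H.Arr) (γ : M.V.Arr) (x : N.H.Arr)
  (e : M.H.tgt h = M.V.src γ) (hs : M.V.src γ = N.H.tgt x) (ht : M.V.tgt γ = N.H.src x)

/-- The arrow `Ω = α(h ◁ γ) x α(h)⁻¹` of `H`. -/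
def omega : N.H.Arr :=
  N.H.comp
    (N.H.comp (φ.α.toFun (M.right.act h γ e)) x
      ((φ.α.tgt_map _).trans ((M.right.q_act _ _ _).trans ht)))
    (N.H.inv (φ.α.toFun h))
    ((N.H.tgt_comp _ _ _).trans
      (hs.symm.trans (e.symm.trans ((φ.α.tgt_map _).symm.trans (N.H.src_inv _).symm))))

theorem src_omega : N.H.src (φ.omega h γ x e hs ht) = M.V.tgt (M.left.act h γ e) := by
  rw [omega, N.H.src_comp, N.H.src_comp, φ.α.src_map, M.tgt_left]

theorem tgt_omega : N.H.tgt (φ.omega h γ x e hs ht) = M.H.src h := by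
  rw [omega, N.H.tgt_comp, N.H.tgt_inv, φ.α.src_map]

theorem omega_inv (hg : N.V.tgt g = M.H.src h) : N.H.tgt (φ.omega h γ x e hs ht) = N.V.src (N.V.inv g) := by
  rw [tgt_omega, N.V.src_inv, hg]

variable (hg : N.V.tgt g = M.H.src h)

/-- The arrow `Ω ◁ g⁻¹` of `H`. -/
def actH : N.H.Arr :=
  N.right.act (φ.omega h γ x e hs ht) (N.V.inv g) (φ.omega_inv g h γ x e hs ht hg)

/-- The arrow `β(g) (h ▷ γ) β(Ω ▷ g⁻¹)` of `𝕍`. -/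
def actV : M.V.Arr :=
  M.V.comp
    (M.V.comp (φ.β.toFun g) (M.left.act h γ e)
      ((φ.β.tgt_map _).trans (hg.trans (M.left.p_act _ _ _).symm)))
    (φ.β.toFun (N.left.act (φ.omega h γ x e hs ht) (N.V.inv g) (φ.omega_inv g h γ x e hs ht hg)))
    ((M.V.tgt_comp _ _ _).trans ((φ.src_omega _ _ _ _ _ _).symm.trans
      ((N.left.p_act _ _ _).symm.trans (φ.β.src_map _).symm)))

theorem src_actV : M.V.src (φ.actV g h γ x e hs ht hg) = N.V.src g := by
  rw [actV, M.V.src_comp, M.V.src_comp, φ.β.src_map]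

theorem tgt_actH : N.H.tgt (φ.actH g h γ x e hs ht hg) = N.V.src g :=
  (N.right.q_act _ _ _).trans (N.V.tgt_inv _)

theorem tgt_actV :
    M.V.tgt (φ.actV g h γ x e hs ht hg) = N.H.src (φ.actH g h γ x e hs ht hg) := by
  rw [actV, actH, M.V.tgt_comp, φ.β.tgt_map, N.tgt_left]

theorem actH_right : N.right.act (φ.actH g h γ x e hs ht hg) g (φ.tgt_actH g h γ x e hs ht hg) =
    φ.omega h γ x e hs ht := by
  unfold actH
  rw [N.right.act_act _ _ _ _ (N.V.tgt_inv g), N.right.congr rfl (N.V.inv_comp g),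
    N.right.act_one']

/-- The arrow `(Ω ◁ g⁻¹) ▷ g` of `V`. -/
def ractV : N.V.Arr := N.left.act (φ.actH g h γ x e hs ht hg) g (φ.tgt_actH g h γ x e hs ht hg)

theorem src_ractV :
    N.V.src (φ.ractV g h γ x e hs ht hg) = N.H.src (φ.actH g h γ x e hs ht hg) :=
  N.left.p_act _ _ _

theorem tgt_ractV : N.V.tgt (φ.ractV g h γ x e hs ht hg) = M.H.src (M.right.act h γ e) := by
  rw [ractV, N.tgt_left, actH_right, src_omega, M.tgt_left]

theorem comp_ractV : M.V.comp (φ.β.toFun g) (M.left.act h γ e)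
      ((φ.β.tgt_map _).trans (hg.trans (M.left.p_act _ _ _).symm)) =
    M.V.comp (φ.actV g h γ x e hs ht hg) (φ.β.toFun (φ.ractV g h γ x e hs ht hg))
      ((φ.tgt_actV _ _ _ _ _ _ _ _).trans
        ((φ.src_ractV _ _ _ _ _ _ _ _).symm.trans (φ.β.src_map _).symm)) := by
  have key := N.left_comp (φ.omega h γ x e hs ht) (N.V.inv g) g
    (φ.omega_inv g h γ x e hs ht hg) (N.V.tgt_inv g)
  rw [N.left.congr rfl (N.V.inv_comp g), N.left_one'] at key
  have key' := (φ.β.map_comp _ _ _).symm.trans ((congrArg φ.β.toFun key.symm).trans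
    (φ.β.map_one _))
  refine Eq.trans ?_ (M.V.assoc' _ _ _ _ _).symm
  exact ((M.V.comp_congr rfl key' _).trans (M.V.comp_one' _ _)).symm

theorem omega_comp : N.H.comp (φ.omega h γ x e hs ht) (φ.α.toFun h)
      ((φ.tgt_omega _ _ _ _ _ _).trans (φ.α.src_map _).symm) =
    N.H.comp (φ.α.toFun (M.right.act h γ e)) x
      ((φ.α.tgt_map _).trans ((M.right.q_act _ _ _).trans ht)) := by
  unfold omega
  rw [N.H.assoc', N.H.comp_congr rfl (N.H.inv_comp _), N.H.comp_one']

end formulas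

/-- `(g, h) ⇀ (γ, x) = (β(g) (h ▷ γ) β(Ω ▷ g⁻¹), Ω ◁ g⁻¹)`. -/
def dLeft (d : φ.dH.Arr) (v : φ.dV.Arr) (e : φ.dH.tgt d = φ.dV.src v) : φ.dV.Arr :=
  ⟨(φ.actV d.1.1 d.1.2 v.1.1 v.1.2 e v.2.1 v.2.2 d.2,
      φ.actH d.1.1 d.1.2 v.1.1 v.1.2 e v.2.1 v.2.2 d.2),
    (φ.src_actV d.1.1 d.1.2 v.1.1 v.1.2 e v.2.1 v.2.2 d.2).trans
      (φ.tgt_actH d.1.1 d.1.2 v.1.1 v.1.2 e v.2.1 v.2.2 d.2).symm,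
    φ.tgt_actV d.1.1 d.1.2 v.1.1 v.1.2 e v.2.1 v.2.2 d.2⟩

/-- `(g, h) ↼ (γ, x) = ((Ω ◁ g⁻¹) ▷ g, h ◁ γ)`. -/
def dRight (d : φ.dH.Arr) (v : φ.dV.Arr) (e : φ.dH.tgt d = φ.dV.src v) : φ.dH.Arr :=
  ⟨(φ.ractV d.1.1 d.1.2 v.1.1 v.1.2 e v.2.1 v.2.2 d.2, M.right.act d.1.2 v.1.1 e),
    φ.tgt_ractV d.1.1 d.1.2 v.1.1 v.1.2 e v.2.1 v.2.2 d.2⟩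

/-- The morphism `V ⋈ ℍ ⟶ V ⋈ H` induced by `α`. -/
def toN : GroupoidOver.Hom φ.dH N.diag where
  toFun d := ⟨(d.1.1, φ.α.toFun d.1.2), d.2.trans (φ.α.src_map _).symm⟩
  src_map _ := rfl
  tgt_map _ := φ.α.tgt_map _
  map_one p := Subtype.ext (Prod.ext rfl (φ.α.map_one p))
  map_comp _ _ h := Subtype.ext (Prod.ext rfl ((φ.α.map_comp _ _ _).trans
    (N.H.comp_congr (φ.map_right _ _ h) rfl _)))

/-- The morphism `V ⋈ ℍ ⟶ 𝕍 ⋈ ℍ` induced by `β`. -/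
def toM : GroupoidOver.Hom φ.dH M.diag where
  toFun d := ⟨(φ.β.toFun d.1.1, d.1.2), (φ.β.tgt_map _).trans d.2⟩
  src_map _ := φ.β.src_map _
  tgt_map _ := rfl
  map_one p := Subtype.ext (Prod.ext (φ.β.map_one p) rfl)
  map_comp _ _ h := Subtype.ext (Prod.ext ((φ.β.map_comp _ _ _).trans
    (M.V.comp_congr rfl (φ.map_left _ _ h) _)) rfl)

end Hom

/-- The inclusion `V ⟶ V ⋈ H`. -/
def inV : GroupoidOver.Hom M.V M.diag where
  toFun f := ⟨(f, M.H.one (M.V.tgt f)), (M.H.src_one _).symm⟩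
  src_map _ := rfl
  tgt_map _ := M.H.tgt_one _
  map_one p := Subtype.ext (Prod.ext rfl (congrArg M.H.one (M.V.tgt_one p)))
  map_comp f g h := Subtype.ext (Prod.ext
    (M.V.comp_congr rfl (M.left.one_act' _ ((M.H.tgt_one _).trans h)).symm _)
    ((congrArg M.H.one (M.V.tgt_comp _ _ _)).trans
      ((M.H.comp_one' _ (by rw [M.right.q_act, M.H.src_one])).trans
        (M.one_right' _ ((M.H.tgt_one _).trans h))).symm))

/-- The inclusion `H ⟶ V ⋈ H`. -/
def inH : GroupoidOver.Hom M.H M.diag where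
  toFun x := ⟨(M.V.one (M.H.src x), x), M.V.tgt_one _⟩
  src_map _ := M.V.src_one _
  tgt_map _ := rfl
  map_one p := Subtype.ext (Prod.ext (congrArg M.V.one (M.H.src_one p)) rfl)
  map_comp f g h := Subtype.ext (Prod.ext
    ((congrArg M.V.one (M.H.src_comp _ _ _)).trans
      ((M.V.one_comp' _ (by rw [M.left.p_act, M.V.tgt_one])).trans
        (M.left_one' _ (h.trans (M.V.src_one _).symm))).symm)
    (M.H.comp_congr (M.right.act_one' _ (h.trans (M.V.src_one _).symm)).symm rfl _))

theorem comp_inV (d : M.diag.Arr) (f : M.V.Arr) (h : M.H.tgt d.1.2 = M.V.src f) :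
    M.diag.comp d (M.inV.toFun f) h =
      ⟨(M.V.comp d.1.1 (M.left.act d.1.2 f h) (d.2.trans (M.left.p_act _ _ _).symm),
        M.right.act d.1.2 f h), (M.V.tgt_comp _ _ _).trans (M.tgt_left _ _ _)⟩ :=
  Subtype.ext (Prod.ext rfl (M.H.comp_one' _ _))

theorem inV_comp (d : M.diag.Arr) (f : M.V.Arr) (h : M.V.tgt f = M.V.src d.1.1) :
    M.diag.comp (M.inV.toFun f) d ((M.H.tgt_one _).trans h) =
      ⟨(M.V.comp f d.1.1 h, d.1.2), (M.V.tgt_comp _ _ _).trans d.2⟩ :=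
  Subtype.ext (Prod.ext
    (M.V.comp_congr rfl (M.left.one_act' _ ((M.H.tgt_one _).trans h)) _)
    ((M.H.comp_congr (M.one_right' _ ((M.H.tgt_one _).trans h)) rfl _).trans
      (M.H.one_comp' _ _)))

theorem comp_inH (d : M.diag.Arr) (x : M.H.Arr) (h : M.H.tgt d.1.2 = M.H.src x) :
    M.diag.comp d (M.inH.toFun x) (h.trans (M.V.src_one _).symm) =
      ⟨(d.1.1, M.H.comp d.1.2 x h), d.2.trans (M.H.src_comp _ _ _).symm⟩ :=
  Subtype.ext (Prod.ext
    ((M.V.comp_congr rfl (M.left_one' _ (h.trans (M.V.src_one _).symm)) _).trans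
      (M.V.comp_one' _ _))
    (M.H.comp_congr (M.right.act_one' _ (h.trans (M.V.src_one _).symm)) rfl _))

theorem inH_comp (d : M.diag.Arr) (x : M.H.Arr) (h : M.H.tgt x = M.V.src d.1.1) :
    M.diag.comp (M.inH.toFun x) d h =
      ⟨(M.left.act x d.1.1 h,
        M.H.comp (M.right.act x d.1.1 h) d.1.2 ((M.right.q_act _ _ _).trans d.2)),
        (M.tgt_left _ _ _).trans (M.H.src_comp _ _ _).symm⟩ :=
  Subtype.ext (Prod.ext (M.V.one_comp' _ _) rfl)

namespace Hom

variable {P : Type u} {M N : MatchedPair P} (φ : Hom M N)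

/-- The commutative squares that characterise the cells of the generalized double. -/
structure IsSquare (d : φ.dH.Arr) (v v' : φ.dV.Arr) (d' : φ.dH.Arr) : Prop where
  c₁ : φ.dH.tgt d = φ.dV.src v
  c₂ : φ.dV.tgt v' = φ.dH.src d'
  c₃ : φ.dV.src v' = φ.dH.src d
  c₄ : φ.dH.tgt d' = φ.dV.tgt v
  sqM : M.diag.comp (φ.toM.toFun d) (M.inV.toFun v.1.1) c₁ =
    M.diag.comp (M.inV.toFun v'.1.1) (φ.toM.toFun d')
      ((M.H.tgt_one _).trans (c₂.trans (φ.β.src_map _).symm))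
  sqN : N.diag.comp (N.inH.toFun v'.1.2) (φ.toN.toFun d) (v'.2.1.symm.trans c₃) =
    N.diag.comp (φ.toN.toFun d') (N.inH.toFun v.1.2)
      ((φ.α.tgt_map _).trans (c₄.trans (v.2.2.trans (N.V.src_one _).symm)))

theorem isSquare (d : φ.dH.Arr) (v : φ.dV.Arr) (e : φ.dH.tgt d = φ.dV.src v) :
    φ.IsSquare d v (φ.dLeft d v e) (φ.dRight d v e) where
  c₁ := e
  c₂ := (φ.tgt_actV d.1.1 d.1.2 v.1.1 v.1.2 e v.2.1 v.2.2 d.2).trans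
    (φ.src_ractV d.1.1 d.1.2 v.1.1 v.1.2 e v.2.1 v.2.2 d.2).symm
  c₃ := φ.src_actV d.1.1 d.1.2 v.1.1 v.1.2 e v.2.1 v.2.2 d.2
  c₄ := M.right.q_act _ _ _
  sqM := by
    refine (M.comp_inV _ _ e).trans (Eq.trans ?_ (M.inV_comp _ _ ?_).symm)
    · exact Subtype.ext (Prod.ext (φ.comp_ractV d.1.1 d.1.2 v.1.1 v.1.2 e v.2.1 v.2.2 d.2) rfl)
    · exact (φ.tgt_actV d.1.1 d.1.2 v.1.1 v.1.2 e v.2.1 v.2.2 d.2).trans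
        ((φ.src_ractV d.1.1 d.1.2 v.1.1 v.1.2 e v.2.1 v.2.2 d.2).symm.trans (φ.β.src_map _).symm)
  sqN := by
    refine (N.inH_comp (φ.toN.toFun d) (φ.dLeft d v e).1.2
      (φ.tgt_actH d.1.1 d.1.2 v.1.1 v.1.2 e v.2.1 v.2.2 d.2)).trans
      (Eq.trans ?_ (N.comp_inH (φ.toN.toFun (φ.dRight d v e)) v.1.2 ?_).symm)
    · exact Subtype.ext (Prod.ext rfl
        ((N.H.comp_congr
          (φ.actH_right d.1.1 d.1.2 v.1.1 v.1.2 e v.2.1 v.2.2 d.2) rfl _).trans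
            (φ.omega_comp d.1.2 v.1.1 v.1.2 e v.2.1 v.2.2)))
    · exact (φ.α.tgt_map _).trans ((M.right.q_act _ _ _).trans v.2.2)

variable {φ}

theorem IsSquare.unique {d : φ.dH.Arr} {v v₁ v₂ : φ.dV.Arr} {d₁ d₂ : φ.dH.Arr}
    (s₁ : φ.IsSquare d v v₁ d₁) (s₂ : φ.IsSquare d v v₂ d₂) : v₁ = v₂ ∧ d₁ = d₂ := by
  obtain ⟨⟨g₁, h₁⟩, p₁⟩ := d₁
  obtain ⟨⟨g₂, h₂⟩, p₂⟩ := d₂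
  obtain ⟨⟨γ₁, x₁⟩, q₁⟩ := v₁
  obtain ⟨⟨γ₂, x₂⟩, q₂⟩ := v₂
  have m₁ := s₁.sqM
  have m₂ := s₂.sqM
  have n₁ := s₁.sqN
  have n₂ := s₂.sqN
  rw [M.comp_inV _ _ s₁.c₁, M.inV_comp _ _ (s₁.c₂.trans (φ.β.src_map _).symm)] at m₁
  rw [M.comp_inV _ _ s₁.c₁, M.inV_comp _ _ (s₂.c₂.trans (φ.β.src_map _).symm)] at m₂
  rw [N.inH_comp _ _ (q₁.1.symm.trans s₁.c₃),
    N.comp_inH _ _ ((φ.α.tgt_map _).trans (s₁.c₄.trans v.2.2))] at n₁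
  rw [N.inH_comp _ _ (q₂.1.symm.trans s₂.c₃),
    N.comp_inH _ _ ((φ.α.tgt_map _).trans (s₂.c₄.trans v.2.2))] at n₂
  have m := m₁.symm.trans m₂
  have hh : h₁ = h₂ := congrArg (fun z => z.1.2) m
  subst hh
  have n₁' := congrArg (fun z => z.1.2) n₁
  have n₂' := congrArg (fun z => z.1.2) n₂
  have hx := N.H.comp_right_cancel (n₁'.trans n₂'.symm)
  have key : ∀ (x : N.H.Arr) (hx : N.H.tgt x = N.V.src d.1.1),
      x = N.right.act (N.right.act x d.1.1 hx) (N.V.inv d.1.1)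
        ((N.right.q_act _ _ _).trans (N.V.src_inv _).symm) := fun x hx => by
    rw [N.right.act_act _ _ _ _ (N.V.src_inv _).symm, N.right.congr rfl (N.V.comp_inv _),
      N.right.act_one']
  have hxx : x₁ = x₂ :=
    (key x₁ (q₁.1.symm.trans s₁.c₃)).trans
      ((N.right.congr hx rfl _).trans (key x₂ (q₂.1.symm.trans s₂.c₃)).symm)
  subst hxx
  have hgg : g₁ = g₂ := (congrArg (fun z => z.1.1) n₁).symm.trans (congrArg (fun z => z.1.1) n₂)
  subst hgg
  have hγ : γ₁ = γ₂ := M.V.comp_right_cancel (congrArg (fun z => z.1.1) m)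
  subst hγ
  exact ⟨rfl, rfl⟩

theorem IsSquare.hcomp {d₁ d₂ : φ.dH.Arr} {v v₁ v₂ : φ.dV.Arr} {d₁' d₂' : φ.dH.Arr}
    (s₂ : φ.IsSquare d₂ v v₂ d₂') (s₁ : φ.IsSquare d₁ v₂ v₁ d₁')
    (h : φ.dH.tgt d₁ = φ.dH.src d₂) (h' : φ.dH.tgt d₁' = φ.dH.src d₂') :
    φ.IsSquare (φ.dH.comp d₁ d₂ h) v v₁ (φ.dH.comp d₁' d₂' h') where
  c₁ := (φ.dH.tgt_comp _ _ _).trans s₂.c₁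
  c₂ := s₁.c₂.trans (φ.dH.src_comp _ _ _).symm
  c₃ := s₁.c₃.trans (φ.dH.src_comp _ _ _).symm
  c₄ := (φ.dH.tgt_comp _ _ _).trans s₂.c₄
  sqM := by
    refine (M.diag.comp_congr (φ.toM.map_comp _ _ h) rfl _).trans (Eq.trans ?_
      (M.diag.comp_congr rfl (φ.toM.map_comp _ _ h') _).symm)
    exact M.diag.paste s₁.sqM s₂.sqM ((φ.toM.tgt_map _).trans (h.trans (φ.toM.src_map _).symm))
      ((φ.toM.tgt_map _).trans (h'.trans (φ.toM.src_map _).symm))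
  sqN := by
    refine (N.diag.comp_congr rfl (φ.toN.map_comp _ _ h) _).trans (Eq.trans ?_
      (N.diag.comp_congr (φ.toN.map_comp _ _ h') rfl _).symm)
    exact (N.diag.paste s₁.sqN.symm s₂.sqN.symm
      ((φ.toN.tgt_map _).trans (h'.trans (φ.toN.src_map _).symm))
      ((φ.toN.tgt_map _).trans (h.trans (φ.toN.src_map _).symm))).symm

theorem IsSquare.vcomp {d d' d'' : φ.dH.Arr} {v v' w w' : φ.dV.Arr}
    (s : φ.IsSquare d v v' d') (t : φ.IsSquare d' w w' d'')
    (h : φ.dV.tgt v = φ.dV.src w) (h' : φ.dV.tgt v' = φ.dV.src w') :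
    φ.IsSquare d (φ.dV.comp v w h) (φ.dV.comp v' w' h') d'' where
  c₁ := s.c₁.trans (φ.dV.src_comp _ _ _).symm
  c₂ := (φ.dV.tgt_comp _ _ _).trans t.c₂
  c₃ := (φ.dV.src_comp _ _ _).trans s.c₃
  c₄ := t.c₄.trans (φ.dV.tgt_comp _ _ _).symm
  sqM := by
    refine (M.diag.comp_congr rfl (M.inV.map_comp _ _ h) _).trans (Eq.trans ?_
      (M.diag.comp_congr (M.inV.map_comp _ _ h') rfl _).symm)
    exact (M.diag.paste s.sqM.symm t.sqM.symm
      ((M.inV.tgt_map _).trans (h'.trans (M.inV.src_map _).symm))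
      ((M.inV.tgt_map _).trans (h.trans (M.inV.src_map _).symm))).symm
  sqN := by
    have k : N.H.tgt w.1.2 = N.H.src v.1.2 := w.2.1.symm.trans (h.symm.trans v.2.2)
    have k' : N.H.tgt w'.1.2 = N.H.src v'.1.2 := w'.2.1.symm.trans (h'.symm.trans v'.2.2)
    refine (N.diag.comp_congr (N.inH.map_comp _ _ k') rfl _).trans (Eq.trans ?_
      (N.diag.comp_congr rfl (N.inH.map_comp _ _ k) _).symm)
    exact N.diag.paste t.sqN s.sqN
      ((N.inH.tgt_map _).trans (k'.trans (N.inH.src_map _).symm))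
      ((N.inH.tgt_map _).trans (k.trans (N.inH.src_map _).symm))

theorem IsSquare.one_left (v : φ.dV.Arr) :
    φ.IsSquare (φ.dH.one (φ.dV.src v)) v v (φ.dH.one (φ.dV.tgt v)) where
  c₁ := φ.dH.tgt_one _
  c₂ := (φ.dH.src_one _).symm
  c₃ := (φ.dH.src_one _).symm
  c₄ := φ.dH.tgt_one _
  sqM := by
    exact ((M.diag.comp_congr (φ.toM.map_one _) rfl _).trans (M.diag.one_comp' _ _)).trans
      ((M.diag.comp_congr rfl (φ.toM.map_one _) _).trans (M.diag.comp_one' _ _)).symm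
  sqN := by
    exact ((N.diag.comp_congr rfl (φ.toN.map_one _) _).trans (N.diag.comp_one' _ _)).trans
      ((N.diag.comp_congr (φ.toN.map_one _) rfl _).trans (N.diag.one_comp' _ _)).symm

theorem IsSquare.one_right (d : φ.dH.Arr) :
    φ.IsSquare d (φ.dV.one (φ.dH.tgt d)) (φ.dV.one (φ.dH.src d)) d where
  c₁ := (φ.dV.src_one _).symm
  c₂ := φ.dV.tgt_one _
  c₃ := φ.dV.src_one _
  c₄ := (φ.dV.tgt_one _).symm
  sqM := by
    exact ((M.diag.comp_congr rfl (M.inV.map_one _) _).trans (M.diag.comp_one' _ _)).trans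
      ((M.diag.comp_congr (M.inV.map_one _) rfl _).trans (M.diag.one_comp' _ _)).symm
  sqN := by
    exact ((N.diag.comp_congr (N.inH.map_one _) rfl _).trans (N.diag.one_comp' _ _)).trans
      ((N.diag.comp_congr rfl (N.inH.map_one _) _).trans (N.diag.comp_one' _ _)).symm

variable (φ)

/-- The generalized double `D(α, β) = (𝕍 ×_P Hᵒᵖ, V ⋈ ℍ)`, where `×_P` is the restricted product. -/
abbrev double : MatchedPair P where
  V := φ.dV
  H := φ.dH
  left :=
    { act := φ.dLeft
      p_act := fun d v e => (φ.isSquare d v e).c₃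
      act_act := fun g k v h₁ h₂ =>
        (((φ.isSquare k v h₂).hcomp
          (φ.isSquare g (φ.dLeft k v h₂) (h₁.trans (φ.isSquare k v h₂).c₃.symm)) h₁
            ((φ.isSquare g _ _).c₄.trans (φ.isSquare k v h₂).c₂)).unique
          (φ.isSquare (φ.dH.comp g k h₁) v ((φ.dH.tgt_comp _ _ _).trans h₂))).1
      one_act := fun v => ((φ.isSquare _ _ _).unique (IsSquare.one_left v)).1 }
  right :=
    { act := φ.dRight
      q_act := fun d v e => (φ.isSquare d v e).c₄
      act_act := fun d v w h₁ h₂ =>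
        (((φ.isSquare d v h₁).vcomp
          (φ.isSquare (φ.dRight d v h₁) w ((φ.isSquare d v h₁).c₄.trans h₂)) h₂
            ((φ.isSquare d v h₁).c₂.trans (φ.isSquare _ w _).c₃.symm)).unique
          (φ.isSquare d (φ.dV.comp v w h₂) (h₁.trans (φ.dV.src_comp _ _ _).symm))).2
      act_one := fun d => ((φ.isSquare _ _ _).unique (IsSquare.one_right d)).2 }
  tgt_left d v e := (φ.isSquare d v e).c₂
  left_comp d v w h₁ h₂ :=
    ((φ.isSquare d (φ.dV.comp v w h₂) (h₁.trans (φ.dV.src_comp _ _ _).symm)).unique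
      ((φ.isSquare d v h₁).vcomp
        (φ.isSquare (φ.dRight d v h₁) w ((φ.isSquare d v h₁).c₄.trans h₂)) h₂
          ((φ.isSquare d v h₁).c₂.trans (φ.isSquare _ w _).c₃.symm))).1
  comp_right g k v h₁ h₂ :=
    ((φ.isSquare (φ.dH.comp g k h₁) v ((φ.dH.tgt_comp _ _ _).trans h₂)).unique
      ((φ.isSquare k v h₂).hcomp
        (φ.isSquare g (φ.dLeft k v h₂) (h₁.trans (φ.isSquare k v h₂).c₃.symm)) h₁
          ((φ.isSquare g _ _).c₄.trans (φ.isSquare k v h₂).c₂))).2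

end Hom
end MatchedPair
/-! ### Quivers and representations -/

/-- A quiver over `P`: a set with two maps to `P`. -/
structure Quiv (P : Type u) where
  carrier : Type u
  p : carrier → P
  q : carrier → P

namespace Quiv

variable {P : Type u}

/-- A morphism of quivers over `P`. -/
@[ext]
structure Hom (X Y : Quiv P) where
  toFun : X.carrier → Y.carrier
  p_map : ∀ e, Y.p (toFun e) = X.p e
  q_map : ∀ e, Y.q (toFun e) = X.q e

instance : Category (Quiv P) where
  Hom := Hom
  id X := ⟨fun e => e, fun _ => rfl, fun _ => rfl⟩
  comp f g := ⟨fun e => g.toFun (f.toFun e), fun _ => (g.p_map _).trans (f.p_map _),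
    fun _ => (g.q_map _).trans (f.q_map _)⟩

/-- The tensor product of quivers: pairs `(e, f)` with `q(e) = p(f)`. -/
abbrev tensor (X Y : Quiv P) : Quiv P where
  carrier := {a : X.carrier × Y.carrier // X.q a.1 = Y.p a.2}
  p a := X.p a.1.1
  q a := Y.q a.1.2

end Quiv

/-- A (set-theoretic) representation of the matched pair `M = (V, H)`: a quiver `(E, p, q)` over `P`
with a left action of `H` on `p` and a grading `E → V`, `e ↦ |e|`, such that `p(e) = t(|e|)`,
`q(e) = b(|e|)` and `|x ▷ e| = x ▷ |e|`. -/
structure Rep {P : Type u} (M : MatchedPair P) extends Quiv P where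
  action : LeftAction M.H p
  deg : carrier → M.V.Arr
  src_deg : ∀ e, M.V.src (deg e) = p e
  tgt_deg : ∀ e, M.V.tgt (deg e) = q e
  deg_act : ∀ x e (h : M.H.tgt x = p e),
    deg (action.act x e h) = M.left.act x (deg e) (h.trans (src_deg e).symm)

namespace Rep

variable {P : Type u} {M : MatchedPair P}

/-- A morphism of representations: a map that intertwines the actions and preserves the
gradings. -/
@[ext]
structure Hom (E F : Rep M) where
  toFun : E.carrier → F.carrier
  p_map : ∀ e, F.p (toFun e) = E.p e
  q_map : ∀ e, F.q (toFun e) = E.q e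
  map_act : ∀ x e (h : M.H.tgt x = E.p e),
    toFun (E.action.act x e h) = F.action.act x (toFun e) (h.trans (p_map e).symm)
  map_deg : ∀ e, F.deg (toFun e) = E.deg e

instance : Category (Rep M) where
  Hom := Hom
  id X :=
    { toFun := fun e => e
      p_map := fun _ => rfl
      q_map := fun _ => rfl
      map_act := fun _ _ _ => rfl
      map_deg := fun _ => rfl }
  comp f g :=
    { toFun := fun e => g.toFun (f.toFun e)
      p_map := fun _ => (g.p_map _).trans (f.p_map _)
      q_map := fun _ => (g.q_map _).trans (f.q_map _)
      map_act := fun x e h => (congrArg g.toFun (f.map_act x e h)).trans (g.map_act _ _ _)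
      map_deg := fun _ => (g.map_deg _).trans (f.map_deg _) }

theorem hom_ext {E F : Rep M} {f g : E ⟶ F} (h : ∀ e, Hom.toFun f e = Hom.toFun g e) : f = g :=
  Hom.ext (funext h)

/-- The functor `Rep(V, H) ⥤ Quiv(P)` that forgets the action and the grading. -/
def forget (M : MatchedPair P) : Rep M ⥤ Quiv P where
  obj E := E.toQuiv
  map f := ⟨Hom.toFun f, Hom.p_map f, Hom.q_map f⟩

/-- An isomorphism of representations from mutually inverse morphisms. -/
def mkIso {E F : Rep M} (f : E ⟶ F) (g : F ⟶ E) (h₁ : ∀ e, Hom.toFun g (Hom.toFun f e) = e)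
    (h₂ : ∀ e, Hom.toFun f (Hom.toFun g e) = e) : E ≅ F where
  hom := f
  inv := g
  hom_inv_id := hom_ext h₁
  inv_hom_id := hom_ext h₂

/-- The right end of `x ◁ |e|` is `q(e)`, hence `x ◁ |e|` acts on `f` if `q(e) = p(f)`. -/
theorem composable (E F : Rep M) (x : M.H.Arr) (a : (E.toQuiv.tensor F.toQuiv).carrier)
    (h : M.H.tgt x = E.p a.1.1) :
    M.H.tgt (M.right.act x (E.deg a.1.1) (h.trans (E.src_deg _).symm)) = F.p a.1.2 :=
  (M.right.q_act _ _ _).trans ((E.tgt_deg _).trans a.2)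

theorem q_act (E : Rep M) (x : M.H.Arr) (e : E.carrier) (h : M.H.tgt x = E.p e) :
    E.q (E.action.act x e h) =
      M.H.src (M.right.act x (E.deg e) (h.trans (E.src_deg e).symm)) :=
  (E.tgt_deg _).symm.trans ((congrArg M.V.tgt (E.deg_act x e h)).trans (M.tgt_left _ _ _))

theorem comp_right (E : Rep M) (x y : M.H.Arr) (e : E.carrier) (h₁ : M.H.tgt x = M.H.src y)
    (h₂ : M.H.tgt y = E.p e) :
    M.H.comp (M.right.act x (E.deg (E.action.act y e h₂))
        ((h₁.trans (E.action.p_act _ _ _).symm).trans (E.src_deg _).symm))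
      (M.right.act y (E.deg e) (h₂.trans (E.src_deg e).symm))
      ((M.right.q_act _ _ _).trans ((E.tgt_deg _).trans (E.q_act y e h₂))) =
    M.right.act (M.H.comp x y h₁) (E.deg e)
      (((M.H.tgt_comp _ _ _).trans h₂).trans (E.src_deg e).symm) :=
  (M.H.comp_congr (M.right.congr rfl (E.deg_act _ _ _) _) rfl _).trans
    (M.comp_right x y (E.deg e) h₁ (h₂.trans (E.src_deg e).symm)).symm

/-- The tensor product of representations, with `x ▷ (e, f) = (x ▷ e, (x ◁ |e|) ▷ f)` and
`|(e, f)| = |e| |f|`. -/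
def tensorObj (E F : Rep M) : Rep M where
  toQuiv := E.toQuiv.tensor F.toQuiv
  action :=
    { act := fun x a h =>
        ⟨(E.action.act x a.1.1 h,
          F.action.act (M.right.act x (E.deg a.1.1) (h.trans (E.src_deg _).symm)) a.1.2
            (composable E F x a h)),
          (E.q_act x a.1.1 h).trans (F.action.p_act _ _ _).symm⟩
      p_act := fun _ _ _ => E.action.p_act _ _ _
      act_act := fun x y a h₁ h₂ => by
        exact Subtype.ext (Prod.ext (E.action.act_act x y a.1.1 h₁ h₂)
          ((F.action.act_act _ _ a.1.2
            ((M.right.q_act _ _ _).trans ((E.tgt_deg _).trans (E.q_act y a.1.1 h₂))) _).trans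
            (F.action.congr (E.comp_right x y a.1.1 h₁ h₂) rfl _)))
      one_act := fun a => Subtype.ext (Prod.ext (E.action.one_act _)
        ((F.action.congr (M.one_right' _ _) rfl _).trans (F.action.one_act' _ _))) }
  deg a := M.V.comp (E.deg a.1.1) (F.deg a.1.2)
    ((E.tgt_deg _).trans (a.2.trans (F.src_deg _).symm))
  src_deg _ := (M.V.src_comp _ _ _).trans (E.src_deg _)
  tgt_deg _ := (M.V.tgt_comp _ _ _).trans (F.tgt_deg _)
  deg_act x a h := by
    rw [M.left_comp _ _ _ (h.trans (E.src_deg _).symm)]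
    exact M.V.comp_congr (E.deg_act _ _ _) (F.deg_act _ _ _) _

/-- The unit representation `P`, with `x ▷ r(x) = l(x)` and `|p| = id p`. -/
def unit (M : MatchedPair P) : Rep M where
  carrier := P
  p e := e
  q e := e
  action :=
    { act := fun x _ _ => M.H.src x
      p_act := fun _ _ _ => rfl
      act_act := fun _ _ _ _ _ => (M.H.src_comp _ _ _).symm
      one_act := fun _ => M.H.src_one _ }
  deg e := M.V.one e
  src_deg _ := M.V.src_one _
  tgt_deg _ := M.V.tgt_one _
  deg_act _ _ _ := (M.left_one' _ _).symm

/-- The tensor product of morphisms of representations. -/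
def tensorHom {E E' F F' : Rep M} (f : E ⟶ E') (g : F ⟶ F') : tensorObj E F ⟶ tensorObj E' F' where
  toFun a := ⟨(Hom.toFun f a.1.1, Hom.toFun g a.1.2),
    (Hom.q_map f _).trans (a.2.trans (Hom.p_map g _).symm)⟩
  p_map _ := Hom.p_map f _
  q_map _ := Hom.q_map g _
  map_act x a h := Subtype.ext (Prod.ext (Hom.map_act f _ _ _)
    ((Hom.map_act g _ _ (composable E F x a h)).trans (F'.action.congr
      (M.right.congr rfl (Hom.map_deg f _).symm (h.trans (E.src_deg _).symm)) rfl _)))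
  map_deg a := M.V.comp_congr (Hom.map_deg f _) (Hom.map_deg g _) _

/-- The associativity isomorphism `((e, f), k) ↦ (e, (f, k))`. -/
def associator (E F K : Rep M) :
    tensorObj (tensorObj E F) K ≅ tensorObj E (tensorObj F K) :=
  mkIso
    { toFun := fun a => ⟨(a.1.1.1.1, ⟨(a.1.1.1.2, a.1.2), a.2⟩), a.1.1.2⟩
      p_map := fun _ => rfl
      q_map := fun _ => rfl
      map_act := fun x a h => Subtype.ext (Prod.ext rfl (Subtype.ext (Prod.ext rfl
        (K.action.congr (M.right.act_act _ _ _ _ _).symm rfl _))))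
      map_deg := fun a => (M.V.assoc' _ _ _ _ _).symm }
    { toFun := fun a => ⟨(⟨(a.1.1, a.1.2.1.1), a.2⟩, a.1.2.1.2), a.1.2.2⟩
      p_map := fun _ => rfl
      q_map := fun _ => rfl
      map_act := fun x a h => Subtype.ext (Prod.ext rfl
        (K.action.congr (M.right.act_act _ _ _ _ _) rfl _))
      map_deg := fun a => M.V.assoc' _ _ _ _ _ }
    (fun _ => rfl) (fun _ => rfl)

/-- The isomorphism `(p(e), e) ↦ e`. -/
def leftUnitor (E : Rep M) : tensorObj (unit M) E ≅ E :=
  mkIso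
    { toFun := fun a => a.1.2
      p_map := fun a => a.2.symm
      q_map := fun _ => rfl
      map_act := fun x a h =>
        E.action.congr (M.right.act_one' _ _) rfl (composable (unit M) E x a h)
      map_deg := fun a => (M.V.one_comp' _ _).symm }
    { toFun := fun e => ⟨(E.p e, e), rfl⟩
      p_map := fun _ => rfl
      q_map := fun _ => rfl
      map_act := fun x e h => Subtype.ext (Prod.ext (E.action.p_act _ _ _)
        (E.action.congr (M.right.act_one' _ _).symm rfl _))
      map_deg := fun e => M.V.one_comp' _ _ }
    (fun a => Subtype.ext (Prod.ext a.2.symm rfl)) (fun _ => rfl)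

/-- The isomorphism `(e, q(e)) ↦ e`. -/
def rightUnitor (E : Rep M) : tensorObj E (unit M) ≅ E :=
  mkIso
    { toFun := fun a => a.1.1
      p_map := fun _ => rfl
      q_map := fun a => a.2
      map_act := fun _ _ _ => rfl
      map_deg := fun a => (M.V.comp_one' _ _).symm }
    { toFun := fun e => ⟨(e, E.q e), rfl⟩
      p_map := fun _ => rfl
      q_map := fun _ => rfl
      map_act := fun x e h => Subtype.ext (Prod.ext rfl (E.q_act x e h))
      map_deg := fun e => M.V.comp_one' _ _ }
    (fun a => Subtype.ext (Prod.ext rfl a.2)) (fun _ => rfl)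

instance : MonoidalCategory (Rep M) where
  tensorObj := tensorObj
  tensorHom := tensorHom
  whiskerLeft E _ _ f := tensorHom (𝟙 E) f
  whiskerRight f F := tensorHom f (𝟙 F)
  tensorUnit := unit M
  associator := associator
  leftUnitor := leftUnitor
  rightUnitor := rightUnitor
  tensorHom_def _ _ := rfl
  id_tensorHom_id _ _ := rfl
  tensorHom_comp_tensorHom _ _ _ _ := rfl
  whiskerLeft_id _ _ := rfl
  id_whiskerRight _ _ := rfl
  associator_naturality _ _ _ := rfl
  leftUnitor_naturality _ := rfl
  rightUnitor_naturality _ := rfl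
  pentagon _ _ _ _ := rfl
  triangle E F := hom_ext fun a => Subtype.ext (Prod.ext rfl rfl)

end Rep

/-! ### Restriction along a morphism of matched pairs -/

namespace MatchedPair.Hom

variable {P : Type u} {M N : MatchedPair P} (φ : Hom M N)

/-- The representation `Res(E)` of `(𝕍, ℍ)`: the quiver of `E`, with `h ▷ e = α(h) ▷ e` and
`‖e‖ = β(|e|)`. -/
def resObj (E : Rep N) : Rep M where
  toQuiv := E.toQuiv
  action :=
    { act := fun h e w => E.action.act (φ.α.toFun h) e ((φ.α.tgt_map h).trans w)
      p_act := fun _ _ _ => (E.action.p_act _ _ _).trans (φ.α.src_map _)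
      act_act := fun g k e h₁ h₂ => by
        rw [E.action.act_act _ _ _ ((φ.α.tgt_map g).trans (h₁.trans (φ.α.src_map k).symm))]
        exact E.action.congr (φ.α.map_comp _ _ _).symm rfl _
      one_act := fun e => by
        rw [E.action.congr (φ.α.map_one _) rfl, E.action.one_act'] }
  deg e := φ.β.toFun (E.deg e)
  src_deg e := (φ.β.src_map _).trans (E.src_deg e)
  tgt_deg e := (φ.β.tgt_map _).trans (E.tgt_deg e)
  deg_act x e h := by
    rw [E.deg_act]
    exact φ.map_left x (E.deg e) (h.trans (E.src_deg e).symm)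

/-- The restriction functor `Rep(V, H) ⥤ Rep(𝕍, ℍ)` along `(α, β)`. -/
def res : Rep N ⥤ Rep M where
  obj := φ.resObj
  map f :=
    { toFun := Rep.Hom.toFun (M := N) f
      p_map := Rep.Hom.p_map (M := N) f
      q_map := Rep.Hom.q_map (M := N) f
      map_act := fun _ _ _ => Rep.Hom.map_act (M := N) f _ _ _
      map_deg := fun e => φ.βcongr (Rep.Hom.map_deg (M := N) f e) }

/-- The restriction functor is (strictly) monoidal: its structure morphisms are identity maps. -/
instance : φ.res.Monoidal :=
  Functor.CoreMonoidal.toMonoidal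
    { εIso := Rep.mkIso
        { toFun := fun e => e
          p_map := fun _ => rfl
          q_map := fun _ => rfl
          map_act := fun x _ _ => (φ.α.src_map x).symm
          map_deg := fun p => φ.β.map_one p }
        { toFun := fun e => e
          p_map := fun _ => rfl
          q_map := fun _ => rfl
          map_act := fun x _ _ => φ.α.src_map x
          map_deg := fun p => (φ.β.map_one p).symm }
        (fun _ => rfl) (fun _ => rfl)
      μIso := fun E F => Rep.mkIso
        { toFun := fun a => a
          p_map := fun _ => rfl
          q_map := fun _ => rfl
          map_act := fun x a h => Subtype.ext (Prod.ext rfl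
            (F.action.congr (φ.map_right x (E.deg a.1.1) (h.trans (E.src_deg _).symm)) rfl _))
          map_deg := fun a => φ.β.map_comp _ _ _ }
        { toFun := fun a => a
          p_map := fun _ => rfl
          q_map := fun _ => rfl
          map_act := fun x a h => Subtype.ext (Prod.ext rfl
            (F.action.congr (φ.map_right x (E.deg a.1.1) (h.trans (E.src_deg _).symm)).symm rfl _))
          map_deg := fun a => (φ.β.map_comp _ _ _).symm }
        (fun _ => rfl) (fun _ => rfl)
      μIso_hom_natural_left := fun _ _ => rfl
      μIso_hom_natural_right := fun _ _ => rfl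
      associativity := fun _ _ _ => rfl
      left_unitality := fun _ => rfl
      right_unitality := fun _ => rfl }

end MatchedPair.Hom

/-! ### Centralizers of monoidal functors and strictness -/

section Centralizer

open Functor.LaxMonoidal

variable {C : Type u₁} [Category.{v₁} C] [MonoidalCategory C]
  {D : Type u₂} [Category.{v₂} D] [MonoidalCategory D]

/-- The objects `(D, ζ)` of the centralizer of a monoidal functor `F`: an object `D` of the target
with a natural isomorphism `ζ_X : F(X) ⊗ D ≅ D ⊗ F(X)` compatible with tensor products and with the
unit. -/
structure Centralizer (F : C ⥤ D) [F.Monoidal] where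
  obj : D
  ζ : ∀ X : C, F.obj X ⊗ obj ≅ obj ⊗ F.obj X
  naturality : ∀ {X Y : C} (f : X ⟶ Y),
    F.map f ▷ obj ≫ (ζ Y).hom = (ζ X).hom ≫ obj ◁ F.map f
  tensor : ∀ X Y : C, μ F X Y ▷ obj ≫ (ζ (X ⊗ Y)).hom =
    (α_ _ _ _).hom ≫ F.obj X ◁ (ζ Y).hom ≫ (α_ _ _ _).inv ≫ (ζ X).hom ▷ F.obj Y ≫
      (α_ _ _ _).hom ≫ obj ◁ μ F X Y
  unit : ε F ▷ obj ≫ (ζ (𝟙_ C)).hom = (λ_ obj).hom ≫ (ρ_ obj).inv ≫ obj ◁ ε F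

namespace Centralizer

variable {F : C ⥤ D} [F.Monoidal]

/-- A morphism `(D, ζ) ⟶ (E, ϑ)` of the centralizer. -/
@[ext]
structure Hom (A B : Centralizer F) where
  hom : A.obj ⟶ B.obj
  comm : ∀ X : C, F.obj X ◁ hom ≫ (B.ζ X).hom = (A.ζ X).hom ≫ hom ▷ F.obj X

instance : Category (Centralizer F) where
  Hom := Hom
  id A := ⟨𝟙 A.obj, fun X => by simp⟩
  comp f g := ⟨f.hom ≫ g.hom, fun X => by
    rw [MonoidalCategory.whiskerLeft_comp, Category.assoc, g.comm, ← Category.assoc, f.comm,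
      Category.assoc, comp_whiskerRight]⟩
  id_comp f := Hom.ext (Category.id_comp f.hom)
  comp_id f := Hom.ext (Category.comp_id f.hom)
  assoc f g h := Hom.ext (Category.assoc f.hom g.hom h.hom)

theorem hom_ext {A B : Centralizer F} {f g : A ⟶ B} (h : Hom.hom f = Hom.hom g) : f = g :=
  Hom.ext h

/-- An isomorphism of the target category that is a morphism of the centralizer is an isomorphism of
the centralizer. -/
def mkIso {A B : Centralizer F} (i : A.obj ≅ B.obj)
    (comm : ∀ X : C, F.obj X ◁ i.hom ≫ (B.ζ X).hom = (A.ζ X).hom ≫ i.hom ▷ F.obj X) : A ≅ B where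
  hom := ⟨i.hom, comm⟩
  inv := ⟨i.inv, fun X => by
    rw [← cancel_epi (F.obj X ◁ i.hom), ← cancel_mono (i.hom ▷ F.obj X)]
    simp [comm X]⟩
  hom_inv_id := hom_ext i.hom_inv_id
  inv_hom_id := hom_ext i.inv_hom_id

/-- The tensor product `(D, ζ) ⊗ (E, ϑ) = (D ⊗ E, (D ⊗ ϑ) ∘ (ζ ⊗ E))`. -/
def tensorObj (A B : Centralizer F) : Centralizer F where
  obj := A.obj ⊗ B.obj
  ζ X := (α_ _ _ _).symm ≪≫ whiskerRightIso (A.ζ X) B.obj ≪≫ α_ _ _ _ ≪≫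
    whiskerLeftIso A.obj (B.ζ X) ≪≫ (α_ _ _ _).symm
  naturality {X Y} f := by
    simp only [Iso.trans_hom, MonoidalCategory.whiskerLeftIso_hom, Iso.symm_hom, MonoidalCategory.whiskerRightIso_hom]
    calc
      _ = 𝟙 _ ⊗≫ (F.map f ▷ A.obj ≫ (A.ζ Y).hom) ▷ B.obj ⊗≫ A.obj ◁ (B.ζ Y).hom ⊗≫ 𝟙 _ := by
        monoidal
      _ = 𝟙 _ ⊗≫ (A.ζ X).hom ▷ B.obj ⊗≫ A.obj ◁ (F.map f ▷ B.obj ≫ (B.ζ Y).hom) ⊗≫ 𝟙 _ := by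
        rw [A.naturality]; monoidal
      _ = _ := by rw [B.naturality]; monoidal
  tensor X Y := by
    simp only [Iso.trans_hom, MonoidalCategory.whiskerLeftIso_hom, Iso.symm_hom, MonoidalCategory.whiskerRightIso_hom]
    calc
      _ = 𝟙 _ ⊗≫ (μ F X Y ▷ A.obj ≫ (A.ζ (X ⊗ Y)).hom) ▷ B.obj ⊗≫
          A.obj ◁ (B.ζ (X ⊗ Y)).hom ⊗≫ 𝟙 _ := by monoidal
      _ = 𝟙 _ ⊗≫ F.obj X ◁ (A.ζ Y).hom ▷ B.obj ⊗≫ (A.ζ X).hom ▷ F.obj Y ▷ B.obj ⊗≫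
          A.obj ◁ (μ F X Y ▷ B.obj ≫ (B.ζ (X ⊗ Y)).hom) ⊗≫ 𝟙 _ := by
        rw [A.tensor]; monoidal
      _ = 𝟙 _ ⊗≫ F.obj X ◁ (A.ζ Y).hom ▷ B.obj ⊗≫
          ((A.ζ X).hom ▷ (F.obj Y ⊗ B.obj) ≫ _ ◁ (B.ζ Y).hom) ⊗≫
          A.obj ◁ (B.ζ X).hom ▷ F.obj Y ⊗≫ A.obj ◁ B.obj ◁ μ F X Y ⊗≫ 𝟙 _ := by
        rw [B.tensor]; monoidal
      _ = _ := by rw [← whisker_exchange]; monoidal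
  unit := by
    simp only [Iso.trans_hom, MonoidalCategory.whiskerLeftIso_hom, Iso.symm_hom, MonoidalCategory.whiskerRightIso_hom]
    calc
      _ = 𝟙 _ ⊗≫ (ε F ▷ A.obj ≫ (A.ζ (𝟙_ C)).hom) ▷ B.obj ⊗≫
          A.obj ◁ (B.ζ (𝟙_ C)).hom ⊗≫ 𝟙 _ := by monoidal
      _ = 𝟙 _ ⊗≫ A.obj ◁ (ε F ▷ B.obj ≫ (B.ζ (𝟙_ C)).hom) ⊗≫ 𝟙 _ := by
        rw [A.unit]; monoidal
      _ = _ := by rw [B.unit]; monoidal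

/-- The unit object `(𝟙, id)`. -/
def tensorUnit (F : C ⥤ D) [F.Monoidal] : Centralizer F where
  obj := 𝟙_ D
  ζ X := ρ_ (F.obj X) ≪≫ (λ_ (F.obj X)).symm
  naturality f := by simp
  tensor X Y := by
    simp only [Iso.trans_hom, Iso.symm_hom]
    monoidal
  unit := by
    simp only [Iso.trans_hom, Iso.symm_hom]
    monoidal

/-- The tensor product of morphisms. -/
def tensorHom {A A' B B' : Centralizer F} (f : A ⟶ A') (g : B ⟶ B') :
    tensorObj A B ⟶ tensorObj A' B' where
  hom := Hom.hom f ⊗ₘ Hom.hom g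
  comm X := by
    simp only [tensorObj, Iso.trans_hom, MonoidalCategory.whiskerLeftIso_hom, Iso.symm_hom, MonoidalCategory.whiskerRightIso_hom]
    rw [MonoidalCategory.tensorHom_def]
    calc
      _ = 𝟙 _ ⊗≫ F.obj X ◁ Hom.hom f ▷ B.obj ⊗≫
          ((F.obj X ⊗ A'.obj) ◁ Hom.hom g ≫ (A'.ζ X).hom ▷ B'.obj) ⊗≫
          A'.obj ◁ (B'.ζ X).hom ⊗≫ 𝟙 _ := by monoidal
      _ = 𝟙 _ ⊗≫ (F.obj X ◁ Hom.hom f ≫ (A'.ζ X).hom) ▷ B.obj ⊗≫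
          A'.obj ◁ (F.obj X ◁ Hom.hom g ≫ (B'.ζ X).hom) ⊗≫ 𝟙 _ := by
        rw [whisker_exchange]; monoidal
      _ = 𝟙 _ ⊗≫ (A.ζ X).hom ▷ B.obj ⊗≫
          (Hom.hom f ▷ (F.obj X ⊗ B.obj) ≫ A'.obj ◁ (B.ζ X).hom) ⊗≫
          A'.obj ◁ Hom.hom g ▷ F.obj X ⊗≫ 𝟙 _ := by
        rw [Hom.comm f, Hom.comm g]; monoidal
      _ = _ := by rw [← whisker_exchange]; monoidal

instance : MonoidalCategory (Centralizer F) where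
  tensorObj := tensorObj
  tensorHom := tensorHom
  whiskerLeft A _ _ f := tensorHom (𝟙 A) f
  whiskerRight f B := tensorHom f (𝟙 B)
  tensorUnit := tensorUnit F
  associator A B K := mkIso (α_ A.obj B.obj K.obj) fun X => by
    simp only [tensorObj, Iso.trans_hom, MonoidalCategory.whiskerLeftIso_hom, Iso.symm_hom, MonoidalCategory.whiskerRightIso_hom]
    monoidal
  leftUnitor A := mkIso (λ_ A.obj) fun X => by
    simp only [tensorObj, tensorUnit, Iso.trans_hom, MonoidalCategory.whiskerLeftIso_hom, Iso.symm_hom,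
      MonoidalCategory.whiskerRightIso_hom]
    monoidal
  rightUnitor A := mkIso (ρ_ A.obj) fun X => by
    simp only [tensorObj, tensorUnit, Iso.trans_hom, MonoidalCategory.whiskerLeftIso_hom, Iso.symm_hom,
      MonoidalCategory.whiskerRightIso_hom]
    monoidal
  tensorHom_def f g := hom_ext (by
    change Hom.hom f ⊗ₘ Hom.hom g = (Hom.hom f ⊗ₘ 𝟙 _) ≫ (𝟙 _ ⊗ₘ Hom.hom g)
    rw [MonoidalCategory.tensorHom_comp_tensorHom, Category.comp_id, Category.id_comp])
  id_tensorHom_id _ _ := hom_ext (id_tensorHom_id _ _)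
  tensorHom_comp_tensorHom _ _ _ _ := hom_ext (tensorHom_comp_tensorHom _ _ _ _)
  whiskerLeft_id _ _ := hom_ext (id_tensorHom_id _ _)
  id_whiskerRight _ _ := hom_ext (id_tensorHom_id _ _)
  associator_naturality f g h :=
    hom_ext (associator_naturality (Hom.hom f) (Hom.hom g) (Hom.hom h))
  leftUnitor_naturality f := hom_ext (by
    change (𝟙 _ ⊗ₘ Hom.hom f) ≫ (λ_ _).hom = (λ_ _).hom ≫ Hom.hom f
    simp)
  rightUnitor_naturality f := hom_ext (by
    change (Hom.hom f ⊗ₘ 𝟙 _) ≫ (ρ_ _).hom = (ρ_ _).hom ≫ Hom.hom f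
    simp)
  pentagon A B K L := hom_ext (by
    change ((α_ A.obj B.obj K.obj).hom ⊗ₘ 𝟙 L.obj) ≫ (α_ A.obj (B.obj ⊗ K.obj) L.obj).hom ≫
        (𝟙 A.obj ⊗ₘ (α_ B.obj K.obj L.obj).hom) =
      (α_ (A.obj ⊗ B.obj) K.obj L.obj).hom ≫ (α_ A.obj B.obj (K.obj ⊗ L.obj)).hom
    simp)
  triangle A B := hom_ext (by
    change (α_ A.obj (𝟙_ D) B.obj).hom ≫ (𝟙 A.obj ⊗ₘ (λ_ B.obj).hom) =
      ((ρ_ A.obj).hom ⊗ₘ 𝟙 B.obj)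
    simp)

/-- The functor `U : Z(F) ⥤ D`, `(D, ζ) ↦ D`. -/
def forget (F : C ⥤ D) [F.Monoidal] : Centralizer F ⥤ D where
  obj A := A.obj
  map f := Hom.hom f

end Centralizer

/-- A monoidal functor is strict if it preserves the unit object and tensor products of objects on
the nose and its structure morphisms are identities (transported along these equalities). -/
structure IsStrictMonoidal (F : C ⥤ D) [F.Monoidal] : Prop where
  unit : ∃ h : 𝟙_ D = F.obj (𝟙_ C), ε F = eqToHom h
  tensor : ∀ X Y : C, ∃ h : F.obj X ⊗ F.obj Y = F.obj (X ⊗ Y), μ F X Y = eqToHom h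

end Centralizer

end MatchedPairs

/-!
A representation of the double `D(α, β)` is the same thing as a representation `E` of `(𝕍, ℍ)` with
a second action, by `V`, and a second grading `coact`, by `H`, subject to four compatibilities
(`YetterDrinfeld`): this is the decomposition `(g, h) = (g, 1)(1, h)` in `V ⋈ ℍ`, together with the
characterisation of the actions of the double by `comp_ractV`, `actH_right` and `omega_comp`.

Such a datum defines a half-braiding `ζ_X (y, e) = (e', coact e' ▷ y)` with `e' = |y| ▷ e`
(`YetterDrinfeld.toCentralizer`). Its linearity over `ℍ` and its compatibility with the gradings are
three of the compatibilities; the fourth, `coact (g ▷ e) ◁ g = coact e`, and the fact that `V` acts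
give the tensor axiom.

Conversely, every half-braiding has this form. The representation `Rep.free g` of `(V, H)` on the
arrows `x` of `H` with `r(x) = t(g)`, where `x` has grade `x ▷ g`, represents the functor
`X ↦ {y ∈ X : |y| = g}`. By naturality `ζ` is therefore determined by its values at the generators
of these objects (`Centralizer.braid_eq`), and such a value is a pair consisting of an element
`g ▷ e` and an arrow of `H`. The tensor and unit axioms on generators say that `V` acts and that the
arrow depends on `g ▷ e` only (`Centralizer.vAct_comp`, `Centralizer.cocycle_eq`); linearity over
`ℍ` on generators gives the remaining compatibilities (`Centralizer.vAct_comm`).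

Both constructions keep the quiver and the underlying maps of morphisms. All structure morphisms
(unit and counit of the equivalence, tensorators) are identity maps of sets, so that they are
transports along equalities of objects (`Rep.exists_eq_eqToHom`,
`Centralizer.exists_eq_eqToHom`), and most coherence conditions hold by `rfl`. The monoidal structure
of the inverse functor is the one transported along the equivalence.
-/

namespace MatchedPairs

/-! ### Generalities on actions, representations and transports -/

theorem LeftAction.inv_act_act {P : Type u} {G : GroupoidOver P} {E : Type u} {p : E → P}
    (a : LeftAction G p) (g : G.Arr) (e : E) (h : G.tgt g = p e)
    (h' : G.tgt (G.inv g) = p (a.act g e h)) : a.act (G.inv g) (a.act g e h) h' = e := by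
  rw [a.act_act _ _ _ (G.tgt_inv g), a.congr (G.inv_comp g) rfl, a.one_act']

theorem LeftAction.act_inv_act {P : Type u} {G : GroupoidOver P} {E : Type u} {p : E → P}
    (a : LeftAction G p) (g : G.Arr) (e : E) (h : G.tgt (G.inv g) = p e)
    (h' : G.tgt g = p (a.act (G.inv g) e h)) : a.act g (a.act (G.inv g) e h) h' = e := by
  rw [a.act_act _ _ _ (G.src_inv g).symm, a.congr (G.comp_inv g) rfl, a.one_act']

theorem RightAction.act_act_inv {P : Type u} {G : GroupoidOver P} {E : Type u} {q : E → P}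
    (a : RightAction G q) (e : E) (g : G.Arr) (h : q e = G.src g)
    (h' : q (a.act e g h) = G.src (G.inv g)) : a.act (a.act e g h) (G.inv g) h' = e := by
  rw [a.act_act _ _ _ _ (G.src_inv g).symm, a.congr rfl (G.comp_inv g), a.act_one']

/-- The pullback of a left action along a morphism of groupoids over `P`. -/
def LeftAction.restrict {P : Type u} {G K : GroupoidOver P} {E : Type u} {p : E → P}
    (a : LeftAction K p) (f : GroupoidOver.Hom G K) : LeftAction G p where
  act g e h := a.act (f.toFun g) e ((f.tgt_map g).trans h)
  p_act _ _ _ := (a.p_act _ _ _).trans (f.src_map _)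
  act_act g k e h₁ h₂ :=
    (a.act_act _ _ _ ((f.tgt_map g).trans (h₁.trans (f.src_map k).symm)) _).trans
      (a.congr (f.map_comp _ _ _).symm rfl _)
  one_act e := (a.congr (f.map_one _) rfl _).trans (a.one_act' _ _)

namespace Rep

variable {P : Type u} {M : MatchedPair P}

/-- A morphism of representations with an inverse on the underlying sets is an isomorphism. -/
def isoOfInverse {E F : Rep M} (f : E ⟶ F) (g : F.carrier → E.carrier)
    (h₁ : ∀ e, g (Hom.toFun f e) = e) (h₂ : ∀ e, Hom.toFun f (g e) = e) : E ≅ F :=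
  mkIso f
    { toFun := g
      p_map := fun e => (Hom.p_map f (g e)).symm.trans (congrArg F.p (h₂ e))
      q_map := fun e => (Hom.q_map f (g e)).symm.trans (congrArg F.q (h₂ e))
      map_act := fun x e h => by
        have hp : M.H.tgt x = E.p (g e) :=
          h.trans ((congrArg F.p (h₂ e)).symm.trans (Hom.p_map f (g e)))
        rw [← h₁ (E.action.act x (g e) hp)]
        exact congrArg g ((F.action.congr rfl (h₂ e).symm h).trans (Hom.map_act f x (g e) hp).symm)
      map_deg := fun e => (Hom.map_deg f (g e)).symm.trans (congrArg F.deg (h₂ e)) }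
    h₁ h₂

/-- A morphism of representations whose underlying map is the identity forces its source and target
to be equal, and is the transport along that equality. -/
theorem exists_eq_eqToHom {E F : Rep M} (i : E ⟶ F) (hQ : E.toQuiv = F.toQuiv)
    (hi : Hom.toFun i ≍ (fun e : E.carrier => e)) : ∃ h : E = F, i = eqToHom h := by
  obtain ⟨Q, a, d, _, _, _⟩ := E
  obtain ⟨Q', a', d', _, _, _⟩ := F
  dsimp only at hQ
  subst hQ
  have hi' : Hom.toFun i = fun e => e := eq_of_heq hi
  have hd : d = d' := funext fun e => by
    have := Hom.map_deg i e
    rw [hi'] at this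
    exact this.symm
  have ha : a = a' := by
    have hact : ∀ x e h, a.act x e h = a'.act x e h := fun x e h => by
      have h₁ := Hom.map_act i x e h
      exact (congrFun hi' _).symm.trans (h₁.trans (a'.congr rfl (congrFun hi' _) _))
    obtain ⟨b, _, _, _⟩ := a
    obtain ⟨b', _, _, _⟩ := a'
    have : b = b' := by
      funext x e h
      exact hact x e h
    subst this
    rfl
  subst hd ha
  exact ⟨rfl, hom_ext fun e => congrFun hi' e⟩

end Rep

/-- A morphism of a centralizer that is a transport in the target category is a transport in the
centralizer. -/
theorem Centralizer.exists_eq_eqToHom {C : Type u₁} [Category.{v₁} C] [MonoidalCategory C]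
    {D : Type u₂} [Category.{v₂} D] [MonoidalCategory D] {F : C ⥤ D} [F.Monoidal]
    {A B : Centralizer F} (f : A ⟶ B) (hf : ∃ h : A.obj = B.obj, Hom.hom f = eqToHom h) :
    ∃ h : A = B, f = eqToHom h := by
  obtain ⟨o, z, _, _, _⟩ := A
  obtain ⟨o', z', _, _, _⟩ := B
  obtain ⟨h, hf⟩ := hf
  dsimp only at h
  subst h
  have hz : z = z' := funext fun X => Iso.ext (by
    have := Hom.comm f X
    rw [hf] at this
    simpa using this.symm)
  subst hz
  exact ⟨rfl, hom_ext hf⟩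

variable {P : Type u} {M N : MatchedPair P}

/-! ### Representations of the double in terms of two actions and two gradings -/

/-- The data of a representation of `D(α, β)`, split into parts: a representation of `(𝕍, ℍ)`, an
action of `V`, and a second grading `coact`, with values in `H`. The four axioms say that the action
of `V` is compatible with both gradings and with the action of `ℍ`, and that the action of `ℍ` is
compatible with the second grading. -/
structure YetterDrinfeld (φ : MatchedPair.Hom M N) where
  rep : Rep M
  act : LeftAction N.V rep.p
  coact : rep.carrier → N.H.Arr
  tgt_coact : ∀ e, N.H.tgt (coact e) = rep.p e
  src_coact : ∀ e, N.H.src (coact e) = rep.q e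
  coact_act : ∀ g e (h : N.V.tgt g = rep.p e),
    N.right.act (coact (act.act g e h)) g ((tgt_coact _).trans (act.p_act _ _ _)) = coact e
  deg_act : ∀ g e (h : N.V.tgt g = rep.p e),
    M.V.comp (φ.β.toFun g) (rep.deg e)
        ((φ.β.tgt_map _).trans (h.trans (rep.src_deg _).symm)) =
      M.V.comp (rep.deg (act.act g e h))
        (φ.β.toFun (N.left.act (coact (act.act g e h)) g
          ((tgt_coact _).trans (act.p_act _ _ _))))
        ((rep.tgt_deg _).trans ((src_coact _).symm.trans
          ((N.left.p_act _ _ _).symm.trans (φ.β.src_map _).symm)))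
  act_comm : ∀ u g e (hu : M.H.tgt u = N.V.src g) (h : N.V.tgt g = rep.p e),
    rep.action.act u (act.act g e h) (hu.trans (act.p_act _ _ _).symm) =
      act.act (N.left.act (φ.α.toFun u) g ((φ.α.tgt_map u).trans hu))
        (rep.action.act (M.right.act u (φ.β.toFun g) (hu.trans (φ.β.src_map g).symm)) e
          ((M.right.q_act _ _ _).trans ((φ.β.tgt_map g).trans h)))
        ((φ.mixed.tgt_left u g hu).trans (rep.action.p_act _ _ _).symm)
  coact_comm : ∀ u e (hu : M.H.tgt u = rep.p e),
    N.H.comp (coact (rep.action.act u e hu)) (φ.α.toFun u)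
        ((tgt_coact _).trans ((rep.action.p_act _ _ _).trans (φ.α.src_map u).symm)) =
      N.H.comp (φ.α.toFun (M.right.act u (rep.deg e) (hu.trans (rep.src_deg e).symm))) (coact e)
        ((φ.α.tgt_map _).trans ((M.right.q_act _ _ _).trans
          ((rep.tgt_deg e).trans (src_coact e).symm)))

namespace MatchedPair.Hom

variable (φ : MatchedPair.Hom M N)

theorem omega_one {p : P} (γ : M.V.Arr) (x : N.H.Arr) (e : M.H.tgt (M.H.one p) = M.V.src γ)
    (hs : M.V.src γ = N.H.tgt x) (ht : M.V.tgt γ = N.H.src x) :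
    φ.omega (M.H.one p) γ x e hs ht = x := by
  have h := φ.omega_comp (M.H.one p) γ x e hs ht
  rw [N.H.comp_congr rfl (φ.α.map_one p), N.H.comp_one',
    N.H.comp_congr ((φ.αcongr (M.one_right' γ e)).trans (φ.α.map_one _)) rfl, N.H.one_comp'] at h
  exact h

theorem actH_one {p : P} (h : M.H.Arr) (γ : M.V.Arr) (x : N.H.Arr) (e : M.H.tgt h = M.V.src γ)
    (hs : M.V.src γ = N.H.tgt x) (ht : M.V.tgt γ = N.H.src x)
    (hg : N.V.tgt (N.V.one p) = M.H.src h) :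
    φ.actH (N.V.one p) h γ x e hs ht hg = φ.omega h γ x e hs ht := by
  rw [← φ.actH_right (N.V.one p) h γ x e hs ht hg, N.right.act_one']

theorem actV_one {p : P} (h : M.H.Arr) (γ : M.V.Arr) (x : N.H.Arr) (e : M.H.tgt h = M.V.src γ)
    (hs : M.V.src γ = N.H.tgt x) (ht : M.V.tgt γ = N.H.src x)
    (hg : N.V.tgt (N.V.one p) = M.H.src h) :
    φ.actV (N.V.one p) h γ x e hs ht hg = M.left.act h γ e := by
  have k := φ.comp_ractV (N.V.one p) h γ x e hs ht hg
  rw [M.V.comp_congr (φ.β.map_one p) rfl, M.V.one_comp',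
    M.V.comp_congr rfl (show φ.β.toFun (φ.ractV (N.V.one p) h γ x e hs ht hg) = M.V.one _ from
      (φ.βcongr (N.left_one' _ _)).trans (φ.β.map_one _)), M.V.comp_one'] at k
  exact k.symm

/-- An arrow of `ℍ` stays in `ℍ` under the right action of `𝕍 ×_P Hᵒᵖ`. -/
theorem dRight_inH (h : M.H.Arr) (v : φ.dV.Arr) (e : φ.dH.tgt (φ.mixed.inH.toFun h) = φ.dV.src v) :
    φ.dRight (φ.mixed.inH.toFun h) v e = φ.mixed.inH.toFun (M.right.act h v.1.1 e) := by
  refine Subtype.ext (Prod.ext ?_ rfl)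
  refine (N.left_one' _ _).trans (congrArg N.V.one ?_)
  exact (congrArg N.H.src (φ.actH_one _ _ _ e v.2.1 v.2.2 (N.V.tgt_one _))).trans
    ((φ.src_omega _ _ _ _ _ _).trans (M.tgt_left _ _ _))

/-- An arrow of `V` stays in `V` under the right action of `𝕍 ×_P Hᵒᵖ`. -/
theorem dRight_inV (g : N.V.Arr) (v : φ.dV.Arr) (e : φ.dH.tgt (φ.mixed.inV.toFun g) = φ.dV.src v) :
    φ.dRight (φ.mixed.inV.toFun g) v e =
      φ.mixed.inV.toFun (N.left.act (φ.dLeft (φ.mixed.inV.toFun g) v e).1.2 g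
        (φ.tgt_actH g _ v.1.1 v.1.2 e v.2.1 v.2.2 (φ.mixed.inV.toFun g).2)) := by
  refine Subtype.ext (Prod.ext rfl ?_)
  refine (M.one_right' _ _).trans (congrArg M.H.one ?_)
  refine Eq.trans ?_ (φ.tgt_ractV g _ v.1.1 v.1.2 e v.2.1 v.2.2 (φ.mixed.inV.toFun g).2).symm
  exact ((congrArg M.H.src (M.one_right' _ _)).trans (M.H.src_one _)).symm

/-- The representation of `(𝕍, ℍ)` that underlies a representation of the double: the arrow `h` of `ℍ`
acts as `(1, h)`, and the grade is the component in `𝕍`. -/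
def doubleRes (E : Rep φ.double) : Rep M where
  toQuiv := E.toQuiv
  action := E.action.restrict φ.mixed.inH
  deg e := (E.deg e).1.1
  src_deg := E.src_deg
  tgt_deg := E.tgt_deg
  deg_act u e h := (congrArg (fun v => v.1.1)
    (E.deg_act (φ.mixed.inH.toFun u) e h)).trans (φ.actV_one _ _ _ _ _ _ (N.V.tgt_one _))

/-- A representation of the double, split along the inclusions of `V` and `ℍ` in `V ⋈ ℍ` and the
projections of `𝕍 ×_P Hᵒᵖ` to `𝕍` and `H`. -/
def ofDoubleRep (E : Rep φ.double) : YetterDrinfeld φ where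
  rep := φ.doubleRes E
  act := E.action.restrict φ.mixed.inV
  coact e := (E.deg e).1.2
  tgt_coact e := (E.deg e).2.1.symm.trans (E.src_deg e)
  src_coact e := (E.deg e).2.2.symm.trans (E.tgt_deg e)
  coact_act g e h := by
    have k := E.deg_act (φ.mixed.inV.toFun g) e ((φ.mixed.inV.tgt_map g).trans h)
    refine (N.right.congr (congrArg (fun v => v.1.2) k) rfl _).trans ?_
    exact (φ.actH_right _ _ _ _ _ _ _ (M.H.src_one _).symm).trans (φ.omega_one _ _ _ _ _)
  deg_act g e h := by
    have k := E.deg_act (φ.mixed.inV.toFun g) e ((φ.mixed.inV.tgt_map g).trans h)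
    have h' : φ.dH.tgt (φ.mixed.inV.toFun g) = φ.dV.src (E.deg e) :=
      ((φ.mixed.inV.tgt_map g).trans h).trans (E.src_deg e).symm
    refine Eq.trans ?_ ((φ.comp_ractV g (M.H.one (N.V.tgt g)) (E.deg e).1.1 (E.deg e).1.2 h'
      (E.deg e).2.1 (E.deg e).2.2 (M.H.src_one _).symm).trans ?_)
    · exact M.V.comp_congr rfl (M.left.one_act' _ _).symm _
    · exact M.V.comp_congr (congrArg (fun v => v.1.1) k).symm
        (φ.βcongr (N.left.congr (congrArg (fun v => v.1.2) k).symm rfl _)) _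
  act_comm u g e hu h := by
    have hu' : φ.dH.tgt (φ.mixed.inH.toFun u) = φ.dH.src (φ.mixed.inV.toFun g) := hu
    refine (E.action.act_act _ _ _ hu' ((φ.mixed.inV.tgt_map g).trans h)).trans
      (Eq.trans (E.action.congr ?_ rfl _) (E.action.act_act _ _ _
        ((φ.mixed.inV.tgt_map _).trans ((φ.mixed.tgt_left u g hu).trans
          (φ.mixed.inH.src_map _).symm)) _).symm)
    refine (φ.mixed.comp_inV (φ.mixed.inH.toFun u) g hu).trans (Eq.trans ?_
      (φ.mixed.inV_comp (φ.mixed.inH.toFun (φ.mixed.right.act u g hu)) (φ.mixed.left.act u g hu)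
        ((φ.mixed.tgt_left u g hu).trans (φ.mixed.V.src_one _).symm)).symm)
    exact Subtype.ext (Prod.ext ((N.V.one_comp' _ _).trans (N.V.comp_one' _ _).symm) rfl)
  coact_comm u e hu := by
    have k := E.deg_act (φ.mixed.inH.toFun u) e hu
    refine (N.H.comp_congr ((congrArg (fun v => v.1.2) k).trans (φ.actH_one _ _ _ _ _ _ (N.V.tgt_one _)))
      rfl _).trans (φ.omega_comp _ _ _ _ _ _)

end MatchedPair.Hom

namespace YetterDrinfeld

variable {φ : MatchedPair.Hom M N} (Y : YetterDrinfeld φ)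

/-- The representation of the double assembled from its parts: the arrow `(g, h)` of `V ⋈ ℍ` acts by
`h` and then by `g`. -/
def toDoubleRep : Rep φ.double where
  toQuiv := Y.rep.toQuiv
  action :=
    { act := fun d e h => Y.act.act d.1.1 (Y.rep.action.act d.1.2 e h)
        (d.2.trans (Y.rep.action.p_act _ _ _).symm)
      p_act := fun _ _ _ => Y.act.p_act _ _ _
      act_act := fun d d' e h₁ h₂ => by
        refine (Y.act.congr rfl (Y.act_comm d.1.2 d'.1.1 _ h₁ _) _).trans ?_
        refine (Y.act.act_act _ _ _ (d.2.trans (N.left.p_act _ _ _ |>.trans (φ.α.src_map _)).symm)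
          _).trans ?_
        exact Y.act.congr rfl (Y.rep.action.act_act _ _ _
          ((M.right.q_act _ _ _).trans ((φ.β.tgt_map _).trans d'.2)) h₂) _
      one_act := fun e => (Y.act.one_act' _ _).trans (Y.rep.action.one_act _) }
  deg e := ⟨(Y.rep.deg e, Y.coact e), (Y.rep.src_deg e).trans (Y.tgt_coact e).symm,
    (Y.rep.tgt_deg e).trans (Y.src_coact e).symm⟩
  src_deg := Y.rep.src_deg
  tgt_deg := Y.rep.tgt_deg
  deg_act d e h := by
    obtain ⟨⟨g, u⟩, hd⟩ := d
    have hγ : M.H.tgt u = M.V.src (Y.rep.deg e) := h.trans (Y.rep.src_deg e).symm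
    have hs : M.V.src (Y.rep.deg e) = N.H.tgt (Y.coact e) :=
      (Y.rep.src_deg e).trans (Y.tgt_coact e).symm
    have ht : M.V.tgt (Y.rep.deg e) = N.H.src (Y.coact e) :=
      (Y.rep.tgt_deg e).trans (Y.src_coact e).symm
    have hgu : N.V.tgt g = Y.rep.p (Y.rep.action.act u e h) :=
      hd.trans (Y.rep.action.p_act _ _ _).symm
    -- The `H`-grade of `u ▷ e` is `Ω`, hence that of `g ▷ (u ▷ e)` is `Ω ◁ g⁻¹`.
    have ho : Y.coact (Y.rep.action.act u e h) =
        φ.omega u (Y.rep.deg e) (Y.coact e) hγ hs ht :=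
      N.H.comp_right_cancel ((Y.coact_comm u e h).trans (φ.omega_comp u _ _ hγ hs ht).symm)
    have hx : Y.coact (Y.act.act g (Y.rep.action.act u e h) hgu) =
        φ.actH g u (Y.rep.deg e) (Y.coact e) hγ hs ht hd := by
      have k := (Y.coact_act g (Y.rep.action.act u e h) hgu).trans ho
      exact (N.right.act_act_inv _ g _ ((N.right.q_act _ _ _).trans (N.V.src_inv g).symm)).symm.trans
        (N.right.congr k rfl _)
    refine Subtype.ext (Prod.ext ?_ hx)
    -- The `𝕍`-grades agree after multiplication by `β((Ω ◁ g⁻¹) ▷ g)`.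
    have hc : M.V.tgt (Y.rep.deg (Y.act.act g (Y.rep.action.act u e h) hgu)) =
        M.V.src (φ.β.toFun (φ.ractV g u (Y.rep.deg e) (Y.coact e) hγ hs ht hd)) :=
      (Y.rep.tgt_deg _).trans ((Y.src_coact _).symm.trans ((congrArg N.H.src hx).trans
        ((φ.src_ractV _ _ _ _ _ _ _ _).symm.trans (φ.β.src_map _).symm)))
    refine M.V.comp_right_cancel (h := hc)
      (Eq.trans (Eq.trans ?_ ((Y.deg_act g (Y.rep.action.act u e h) hgu).symm.trans ?_))
        (φ.comp_ractV g u _ _ hγ hs ht hd))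
    · exact M.V.comp_congr rfl (φ.βcongr (N.left.congr hx.symm rfl _)) _
    · exact M.V.comp_congr rfl (Y.rep.deg_act u e h) _

end YetterDrinfeld

/-! ### The half-braiding of a representation of the double -/

namespace YetterDrinfeld

variable {φ : MatchedPair.Hom M N} (Y : YetterDrinfeld φ)

theorem tgt_coact_deg (X : Rep N) (y : X.carrier) (e : Y.rep.carrier)
    (h : N.V.tgt (X.deg y) = Y.rep.p e) :
    N.H.tgt (Y.coact (Y.act.act (X.deg y) e h)) = X.p y :=
  (Y.tgt_coact _).trans ((Y.act.p_act _ _ _).trans (X.src_deg y))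

/-- The half-braiding: the map `(y, e) ↦ (e', x ▷ y)` with `e' = |y| ▷ e`, where `x = coact e'`. -/
def braiding (X : Rep N) : Rep.tensorObj (φ.resObj X) Y.rep ⟶ Rep.tensorObj Y.rep (φ.resObj X) where
  toFun a := ⟨(Y.act.act (X.deg a.1.1) a.1.2 ((X.tgt_deg _).trans a.2),
      X.action.act (Y.coact (Y.act.act (X.deg a.1.1) a.1.2 ((X.tgt_deg _).trans a.2))) a.1.1
        (Y.tgt_coact_deg X _ _ _)),
    (Y.src_coact _).symm.trans (X.action.p_act _ _ _).symm⟩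
  p_map a := (Y.act.p_act _ _ _).trans (X.src_deg _)
  q_map a := (X.q_act _ _ _).trans ((congrArg N.H.src (Y.coact_act _ _ _)).trans (Y.src_coact _))
  map_act u a h := by
    obtain ⟨⟨y, e⟩, hye⟩ := a
    have hu : M.H.tgt u = N.V.src (X.deg y) := h.trans (X.src_deg y).symm
    have hy : N.V.tgt (X.deg y) = Y.rep.p e := (X.tgt_deg y).trans hye
    have k₁ := (Y.act.congr (X.deg_act (φ.α.toFun u) y ((φ.α.tgt_map u).trans h))
      (rfl : Y.rep.action.act (M.right.act u (φ.β.toFun (X.deg y)) _) e _ = _)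
      ((X.tgt_deg _).trans (((Rep.tensorObj (φ.resObj X) Y.rep).action.act u ⟨(y, e), hye⟩ h).2))).trans
        (Y.act_comm u (X.deg y) e hu hy).symm
    refine Subtype.ext (Prod.ext k₁ ?_)
    have hx : M.H.tgt u = Y.rep.p (Y.act.act (X.deg y) e hy) := hu.trans (Y.act.p_act _ _ _).symm
    refine (X.action.congr (congrArg Y.coact k₁) rfl _).trans ?_
    refine (X.action.act_act _ (φ.α.toFun u) y ((Y.tgt_coact _).trans
      ((Y.rep.action.p_act _ _ _).trans (φ.α.src_map u).symm)) ((φ.α.tgt_map u).trans h)).trans ?_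
    refine (X.action.congr (Y.coact_comm u (Y.act.act (X.deg y) e hy) hx) rfl _).trans ?_
    exact (X.action.act_act _ _ y ((φ.α.tgt_map _).trans ((M.right.q_act _ _ _).trans
      ((Y.rep.tgt_deg _).trans (Y.src_coact _).symm))) (Y.tgt_coact_deg X y e hy)).symm
  map_deg a := by
    refine Eq.trans ?_ (Y.deg_act (X.deg a.1.1) a.1.2 ((X.tgt_deg _).trans a.2)).symm
    exact M.V.comp_congr rfl (φ.βcongr (X.deg_act _ _ _)) _

/-- The inverse of the half-braiding, `(e', y') ↦ (y, |y|⁻¹ ▷ e')` with `y = (coact e')⁻¹ ▷ y'`. -/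
def braidingInv (X : Rep N) (b : (Rep.tensorObj Y.rep (φ.resObj X)).carrier) :
    (Rep.tensorObj (φ.resObj X) Y.rep).carrier :=
  have h : N.H.tgt (N.H.inv (Y.coact b.1.1)) = X.p b.1.2 :=
    (N.H.tgt_inv _).trans ((Y.src_coact _).trans b.2)
  have h' : X.p (X.action.act (N.H.inv (Y.coact b.1.1)) b.1.2 h) = Y.rep.p b.1.1 :=
    (X.action.p_act _ _ _).trans ((N.H.src_inv _).trans (Y.tgt_coact _))
  ⟨(X.action.act (N.H.inv (Y.coact b.1.1)) b.1.2 h,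
    Y.act.act (N.V.inv (X.deg (X.action.act (N.H.inv (Y.coact b.1.1)) b.1.2 h))) b.1.1
      ((N.V.tgt_inv _).trans ((X.src_deg _).trans h'))),
    (X.tgt_deg _).symm.trans ((N.V.src_inv _).symm.trans (Y.act.p_act _ _ _).symm)⟩

theorem braidingInv_braiding (X : Rep N) (a : (Rep.tensorObj (φ.resObj X) Y.rep).carrier) :
    Y.braidingInv X (Rep.Hom.toFun (Y.braiding X) a) = a := by
  obtain ⟨⟨y, e⟩, h⟩ := a
  have k : X.action.act (N.H.inv (Y.coact (Y.act.act (X.deg y) e ((X.tgt_deg _).trans h))))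
      (X.action.act (Y.coact (Y.act.act (X.deg y) e ((X.tgt_deg _).trans h))) y
        (Y.tgt_coact_deg X _ _ _)) ((N.H.tgt_inv _).trans (X.action.p_act _ _ _).symm) = y :=
    X.action.inv_act_act _ _ _ _
  exact Subtype.ext (Prod.ext k ((Y.act.congr (congrArg (fun z => N.V.inv (X.deg z)) k) rfl _).trans
    (Y.act.inv_act_act _ _ _ _)))

theorem braiding_braidingInv (X : Rep N) (b : (Rep.tensorObj Y.rep (φ.resObj X)).carrier) :
    Rep.Hom.toFun (Y.braiding X) (Y.braidingInv X b) = b := by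
  obtain ⟨⟨e, y⟩, h⟩ := b
  have k := Y.act.act_inv_act (X.deg (X.action.act (N.H.inv (Y.coact e)) y
    ((N.H.tgt_inv _).trans ((Y.src_coact _).trans h)))) e ((N.V.tgt_inv _).trans ((X.src_deg _).trans
      ((X.action.p_act _ _ _).trans ((N.H.src_inv _).trans (Y.tgt_coact _)))))
    ((N.V.src_inv _).symm.trans (Y.act.p_act _ _ _).symm)
  exact Subtype.ext (Prod.ext k ((X.action.congr (congrArg Y.coact k) rfl _).trans
    (X.action.act_inv_act _ _ _ _)))

/-- The object of the centralizer given by the half-braiding. -/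
def toCentralizer : Centralizer φ.res where
  obj := Y.rep
  ζ X := Rep.isoOfInverse (Y.braiding X) (Y.braidingInv X) (Y.braidingInv_braiding X)
    (Y.braiding_braidingInv X)
  naturality {X X'} f := Rep.hom_ext fun a => by
    obtain ⟨⟨y, e⟩, h⟩ := a
    have k := Y.act.congr (Rep.Hom.map_deg f y) (rfl : e = e)
      ((X'.tgt_deg _).trans ((Rep.Hom.q_map f y).trans h))
    refine Subtype.ext (Prod.ext k ?_)
    refine (X'.action.congr (congrArg Y.coact k) rfl _).trans ?_
    exact (Rep.Hom.map_act f _ y (Y.tgt_coact_deg X y e ((X.tgt_deg _).trans h))).symm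
  tensor X X' := Rep.hom_ext fun a => by
    obtain ⟨⟨⟨⟨y, z⟩, hyz⟩, e⟩, h⟩ := a
    have hz : N.V.tgt (X'.deg z) = Y.rep.p e := (X'.tgt_deg _).trans h
    have hy : N.V.tgt (X.deg y) = N.V.src (X'.deg z) :=
      (X.tgt_deg _).trans (hyz.trans (X'.src_deg _).symm)
    have k := Y.act.act_act (X.deg y) (X'.deg z) e hy hz
    refine Subtype.ext (Prod.ext k.symm (Subtype.ext (Prod.ext ?_ ?_)))
    · exact X.action.congr (congrArg Y.coact k.symm) rfl _
    · refine X'.action.congr ?_ rfl _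
      exact (N.right.congr (congrArg Y.coact k.symm) rfl _).trans (Y.coact_act _ _ _)
  unit := Rep.hom_ext fun a => by
    obtain ⟨⟨p, e⟩, h⟩ := a
    have k : Y.act.act (N.V.one p) e ((N.V.tgt_one p).trans h) = e := Y.act.one_act' e _
    exact Subtype.ext (Prod.ext k ((congrArg (fun e => N.H.src (Y.coact e)) k).trans
      (Y.src_coact e)))

end YetterDrinfeld

/-! ### Free representations on one generator -/

namespace Rep

/-- The representation of `(V, H)` freely generated by one element of grade `g`: its elements are
the arrows `x` of `H` that act on `g`, and `x` has grade `x ▷ g`. -/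
def free (g : N.V.Arr) : Rep N where
  carrier := {x : N.H.Arr // N.H.tgt x = N.V.src g}
  p x := N.H.src x.1
  q x := N.H.src (N.right.act x.1 g x.2)
  action :=
    { act := fun y x h => ⟨N.H.comp y x.1 h, (N.H.tgt_comp _ _ _).trans x.2⟩
      p_act := fun _ _ _ => N.H.src_comp _ _ _
      act_act := fun _ _ _ _ _ => Subtype.ext (N.H.assoc _ _ _ _ _).symm
      one_act := fun _ => Subtype.ext (N.H.one_comp _) }
  deg x := N.left.act x.1 g x.2
  src_deg _ := N.left.p_act _ _ _
  tgt_deg _ := N.tgt_left _ _ _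
  deg_act y x h := (N.left.act_act _ _ _ h _).symm

/-- The generator of `free g`. -/
def freeGen (g : N.V.Arr) : (free g).carrier := ⟨N.H.one (N.V.src g), N.H.tgt_one _⟩

theorem deg_freeGen (g : N.V.Arr) : (free g).deg (freeGen g) = g := N.left.one_act' _ _

theorem p_freeGen (g : N.V.Arr) : (free g).p (freeGen g) = N.V.src g := N.H.src_one _

theorem q_freeGen (g : N.V.Arr) : (free g).q (freeGen g) = N.V.tgt g :=
  (congrArg N.H.src (N.one_right' _ _)).trans (N.H.src_one _)

/-- The morphism from `free g` that sends the generator to a given element of grade `g`. -/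
def freeLift (X : Rep N) (y : X.carrier) {g : N.V.Arr} (hy : X.deg y = g) : free g ⟶ X where
  toFun x := X.action.act x.1 y (x.2.trans ((congrArg N.V.src hy).symm.trans (X.src_deg y)))
  p_map _ := X.action.p_act _ _ _
  q_map x := (X.q_act _ _ _).trans (congrArg N.H.src (N.right.congr rfl hy _))
  map_act u x h := (X.action.act_act _ _ _ h _).symm
  map_deg x := (X.deg_act _ _ _).trans (N.left.congr rfl hy _)

theorem freeLift_freeGen (X : Rep N) (y : X.carrier) {g : N.V.Arr} (hy : X.deg y = g) :
    Rep.Hom.toFun (freeLift X y hy) (freeGen g) = y :=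
  X.action.one_act' _ _

end Rep

/-! ### Recovering the action and the grading from a half-braiding -/

namespace Centralizer

variable {φ : MatchedPair.Hom M N} (A : Centralizer φ.res)

/-- The half-braiding on elements: `ζ_X (y, e)`. -/
def braid (X : Rep N) (y : X.carrier) (e : A.obj.carrier) (h : X.q y = A.obj.p e) :
    (A.obj.toQuiv.tensor X.toQuiv).carrier :=
  Rep.Hom.toFun (A.ζ X).hom ⟨(y, e), h⟩

theorem p_braid (X : Rep N) (y : X.carrier) (e : A.obj.carrier) (h : X.q y = A.obj.p e) :
    A.obj.p (A.braid X y e h).1.1 = X.p y :=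
  Rep.Hom.p_map (A.ζ X).hom ⟨(y, e), h⟩

theorem braid_congr (X : Rep N) {y y' : X.carrier} {e e' : A.obj.carrier} (hy : y = y')
    (he : e = e') (h : X.q y = A.obj.p e) :
    A.braid X y e h = A.braid X y' e' (hy ▸ he ▸ h) := by
  subst hy he; rfl

theorem braid_naturality {X X' : Rep N} (f : X ⟶ X') (y : X.carrier) (e : A.obj.carrier)
    (h : X.q y = A.obj.p e) (h' : X'.q (Rep.Hom.toFun f y) = A.obj.p e) :
    (A.braid X' (Rep.Hom.toFun f y) e h').1 =
      ((A.braid X y e h).1.1, Rep.Hom.toFun f (A.braid X y e h).1.2) :=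
  congrArg (fun k : Rep.tensorObj (φ.resObj X) A.obj ⟶ Rep.tensorObj A.obj (φ.resObj X') =>
    (Rep.Hom.toFun k ⟨(y, e), h⟩).1) (A.naturality f)

theorem braid_tensor (X X' : Rep N) (y : X.carrier) (z : X'.carrier) (e : A.obj.carrier)
    (hyz : X.q y = X'.p z) (h : X'.q z = A.obj.p e)
    (h' : X.q y = A.obj.p (A.braid X' z e h).1.1) :
    (A.braid (Rep.tensorObj X X') ⟨(y, z), hyz⟩ e h).1.1 =
        (A.braid X y (A.braid X' z e h).1.1 h').1.1 ∧
      (A.braid (Rep.tensorObj X X') ⟨(y, z), hyz⟩ e h).1.2.1 =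
        ((A.braid X y (A.braid X' z e h).1.1 h').1.2, (A.braid X' z e h).1.2) :=
  have k := congrArg (fun k : Rep.tensorObj (Rep.tensorObj (φ.resObj X) (φ.resObj X')) A.obj ⟶
      Rep.tensorObj A.obj (φ.resObj (Rep.tensorObj X X')) =>
    (Rep.Hom.toFun k ⟨(⟨(y, z), hyz⟩, e), h⟩).1) (A.tensor X X')
  ⟨congrArg Prod.fst k, congrArg (fun z => z.2.1) k⟩

theorem braid_unit (e : A.obj.carrier) :
    (A.braid (Rep.unit N) (A.obj.p e) e rfl).1.1 = e :=
  congrArg (fun k : Rep.tensorObj (Rep.unit M) A.obj ⟶ Rep.tensorObj A.obj (φ.resObj (Rep.unit N)) =>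
    (Rep.Hom.toFun k ⟨(A.obj.p e, e), rfl⟩).1.1) A.unit

theorem q_freeGen_eq (g : N.V.Arr) (e : A.obj.carrier) (h : N.V.tgt g = A.obj.p e) :
    (Rep.free g).q (Rep.freeGen g) = A.obj.p e :=
  (Rep.q_freeGen g).trans h

/-- The action of `g` on `e`: the first component of the half-braiding at the generator of
grade `g`. -/
def vAct (g : N.V.Arr) (e : A.obj.carrier) (h : N.V.tgt g = A.obj.p e) : A.obj.carrier :=
  (A.braid (Rep.free g) (Rep.freeGen g) e (A.q_freeGen_eq g e h)).1.1

/-- The second component of the half-braiding at the generator of grade `g`. -/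
def cocycle (g : N.V.Arr) (e : A.obj.carrier) (h : N.V.tgt g = A.obj.p e) : N.H.Arr :=
  (A.braid (Rep.free g) (Rep.freeGen g) e (A.q_freeGen_eq g e h)).1.2.1

theorem vAct_congr {g g' : N.V.Arr} {e e' : A.obj.carrier} (hg : g = g') (he : e = e')
    (h : N.V.tgt g = A.obj.p e) : A.vAct g e h = A.vAct g' e' (hg ▸ he ▸ h) := by
  subst hg he; rfl

theorem cocycle_congr {g g' : N.V.Arr} {e e' : A.obj.carrier} (hg : g = g') (he : e = e')
    (h : N.V.tgt g = A.obj.p e) : A.cocycle g e h = A.cocycle g' e' (hg ▸ he ▸ h) := by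
  subst hg he; rfl

theorem p_vAct (g : N.V.Arr) (e : A.obj.carrier) (h : N.V.tgt g = A.obj.p e) :
    A.obj.p (A.vAct g e h) = N.V.src g :=
  (A.p_braid _ _ _ _).trans (Rep.p_freeGen g)

theorem tgt_cocycle (g : N.V.Arr) (e : A.obj.carrier) (h : N.V.tgt g = A.obj.p e) :
    N.H.tgt (A.cocycle g e h) = N.V.src g :=
  (A.braid (Rep.free g) (Rep.freeGen g) e (A.q_freeGen_eq g e h)).1.2.2

theorem src_cocycle (g : N.V.Arr) (e : A.obj.carrier) (h : N.V.tgt g = A.obj.p e) :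
    N.H.src (A.cocycle g e h) = A.obj.q (A.vAct g e h) :=
  (A.braid (Rep.free g) (Rep.freeGen g) e (A.q_freeGen_eq g e h)).2.symm

/-- By naturality, the half-braiding is determined by its values at the free generators. -/
theorem braid_eq (X : Rep N) (y : X.carrier) (e : A.obj.carrier) (h : X.q y = A.obj.p e)
    {g : N.V.Arr} (hy : X.deg y = g) (hg : N.V.tgt g = A.obj.p e) :
    (A.braid X y e h).1 = (A.vAct g e hg, X.action.act (A.cocycle g e hg) y
      ((A.tgt_cocycle _ _ _).trans ((congrArg N.V.src hy).symm.trans (X.src_deg y)))) :=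
  (congrArg Subtype.val (A.braid_congr X (Rep.freeLift_freeGen X y hy).symm rfl h)).trans
    (A.braid_naturality (Rep.freeLift X y hy) (Rep.freeGen g) e (A.q_freeGen_eq g e hg) _)

theorem vAct_one {p : P} (e : A.obj.carrier) (h : N.V.tgt (N.V.one p) = A.obj.p e) :
    A.vAct (N.V.one p) e h = e := by
  have hp : p = A.obj.p e := (N.V.tgt_one p).symm.trans h
  subst hp
  exact (congrArg Prod.fst (A.braid_eq (Rep.unit N) (A.obj.p e) e rfl rfl h)).symm.trans
    (A.braid_unit e)

/-- The compatibility of the half-braiding with tensor products, at the pair of the generators of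
`free f` and `free g`, which has grade `fg`. -/
theorem vAct_comp (f g : N.V.Arr) (e : A.obj.carrier) (h₁ : N.V.tgt f = N.V.src g)
    (h₂ : N.V.tgt g = A.obj.p e) :
    A.vAct (N.V.comp f g h₁) e ((N.V.tgt_comp _ _ _).trans h₂) =
        A.vAct f (A.vAct g e h₂) (h₁.trans (A.p_vAct _ _ _).symm) ∧
      A.cocycle (N.V.comp f g h₁) e ((N.V.tgt_comp _ _ _).trans h₂) =
        A.cocycle f (A.vAct g e h₂) (h₁.trans (A.p_vAct _ _ _).symm) ∧
      N.right.act (A.cocycle (N.V.comp f g h₁) e ((N.V.tgt_comp _ _ _).trans h₂)) f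
        ((A.tgt_cocycle _ _ _).trans (N.V.src_comp _ _ _)) = A.cocycle g e h₂ := by
  have hyz : (Rep.free f).q (Rep.freeGen f) = (Rep.free g).p (Rep.freeGen g) :=
    (Rep.q_freeGen f).trans (h₁.trans (Rep.p_freeGen g).symm)
  have t := A.braid_tensor (Rep.free f) (Rep.free g) (Rep.freeGen f) (Rep.freeGen g) e hyz
    (A.q_freeGen_eq g e h₂) (hyz.trans (A.p_braid _ _ _ _).symm)
  have d : (Rep.tensorObj (Rep.free f) (Rep.free g)).deg ⟨(Rep.freeGen f, Rep.freeGen g), hyz⟩ =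
      N.V.comp f g h₁ := N.V.comp_congr (Rep.deg_freeGen f) (Rep.deg_freeGen g) _
  have b := A.braid_eq (Rep.tensorObj (Rep.free f) (Rep.free g))
    ⟨(Rep.freeGen f, Rep.freeGen g), hyz⟩ e (A.q_freeGen_eq g e h₂) d
    ((N.V.tgt_comp _ _ _).trans h₂)
  have b₂ := (congrArg (fun z => z.2.1) b).symm.trans t.2
  refine ⟨(congrArg Prod.fst b).symm.trans t.1, ?_, ?_⟩
  · exact (N.H.comp_one' _ _).symm.trans (congrArg (fun z => z.1.1) b₂)
  · refine (N.right.congr rfl (Rep.deg_freeGen f).symm _).trans ?_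
    exact (N.H.comp_one' _ _).symm.trans (congrArg (fun z => z.2.1) b₂)

/-- The `H`-grade of `e`: the cocycle at the identity arrow of `V` at `p(e)`, which fixes `e`. -/
def coact (e : A.obj.carrier) : N.H.Arr := A.cocycle (N.V.one (A.obj.p e)) e (N.V.tgt_one _)

theorem cocycle_one {p : P} (e : A.obj.carrier) (h : N.V.tgt (N.V.one p) = A.obj.p e) :
    A.cocycle (N.V.one p) e h = A.coact e :=
  A.cocycle_congr (congrArg N.V.one ((N.V.tgt_one p).symm.trans h)) rfl _

/-- The arrow `cocycle g e` depends on `g` and `e` only through `g ▷ e`. -/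
theorem cocycle_eq (g : N.V.Arr) (e : A.obj.carrier) (h : N.V.tgt g = A.obj.p e) :
    A.cocycle g e h = A.coact (A.vAct g e h) :=
  (A.cocycle_congr (N.V.one_comp g).symm rfl h).trans
    ((A.vAct_comp (N.V.one (N.V.src g)) g e (N.V.tgt_one _) h).2.1.trans (A.cocycle_one _ _))

theorem tgt_coact (e : A.obj.carrier) : N.H.tgt (A.coact e) = A.obj.p e :=
  (A.tgt_cocycle _ _ _).trans (N.V.src_one _)

theorem src_coact (e : A.obj.carrier) : N.H.src (A.coact e) = A.obj.q e :=
  (A.src_cocycle _ _ _).trans (congrArg A.obj.q (A.vAct_one e _))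

/-- Equivariance of the half-braiding under `ℍ`, at a free generator. -/
theorem vAct_comm (u : M.H.Arr) (g : N.V.Arr) (e : A.obj.carrier) (hu : M.H.tgt u = N.V.src g)
    (h : N.V.tgt g = A.obj.p e) :
    A.obj.action.act u (A.vAct g e h) (hu.trans (A.p_vAct _ _ _).symm) =
        A.vAct (N.left.act (φ.α.toFun u) g ((φ.α.tgt_map u).trans hu))
          (A.obj.action.act (M.right.act u (φ.β.toFun g) (hu.trans (φ.β.src_map g).symm)) e
            ((M.right.q_act _ _ _).trans ((φ.β.tgt_map g).trans h)))
          ((φ.mixed.tgt_left u g hu).trans (A.obj.action.p_act _ _ _).symm) ∧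
      N.H.comp (A.cocycle (N.left.act (φ.α.toFun u) g ((φ.α.tgt_map u).trans hu))
          (A.obj.action.act (M.right.act u (φ.β.toFun g) (hu.trans (φ.β.src_map g).symm)) e
            ((M.right.q_act _ _ _).trans ((φ.β.tgt_map g).trans h)))
          ((φ.mixed.tgt_left u g hu).trans (A.obj.action.p_act _ _ _).symm)) (φ.α.toFun u)
          ((A.tgt_cocycle _ _ _).trans (N.left.p_act _ _ _)) =
        N.H.comp (φ.α.toFun (M.right.act u (A.obj.deg (A.vAct g e h))
          (hu.trans ((A.p_vAct _ _ _).symm.trans (A.obj.src_deg _).symm)))) (A.cocycle g e h)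
          ((φ.α.tgt_map _).trans ((M.right.q_act _ _ _).trans
            ((A.obj.tgt_deg _).trans (A.src_cocycle _ _ _).symm))) := by
  have hu' : M.H.tgt u = (Rep.free g).p (Rep.freeGen g) := hu.trans (Rep.p_freeGen g).symm
  have k := congrArg Subtype.val (Rep.Hom.map_act (A.ζ (Rep.free g)).hom u
    ⟨(Rep.freeGen g, e), A.q_freeGen_eq g e h⟩ hu')
  have hd : (Rep.free g).deg ((Rep.free g).action.act (φ.α.toFun u) (Rep.freeGen g)
      ((φ.α.tgt_map u).trans hu')) = N.left.act (φ.α.toFun u) g ((φ.α.tgt_map u).trans hu) :=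
    ((Rep.free g).deg_act _ _ _).trans (N.left.congr rfl (Rep.deg_freeGen g) _)
  have he : A.obj.action.act (M.right.act u (φ.β.toFun ((Rep.free g).deg (Rep.freeGen g)))
      (hu'.trans ((φ.resObj (Rep.free g)).src_deg (Rep.freeGen g)).symm)) e
        (Rep.composable (φ.resObj (Rep.free g)) A.obj u
          ⟨(Rep.freeGen g, e), A.q_freeGen_eq g e h⟩ hu') =
      A.obj.action.act (M.right.act u (φ.β.toFun g) (hu.trans (φ.β.src_map g).symm)) e
            ((M.right.q_act _ _ _).trans ((φ.β.tgt_map g).trans h)) :=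
    A.obj.action.congr (M.right.congr rfl (φ.βcongr (Rep.deg_freeGen g)) _) rfl _
  have b := (A.braid_eq (Rep.free g) ((Rep.free g).action.act (φ.α.toFun u) (Rep.freeGen g)
    ((φ.α.tgt_map u).trans hu')) _
    (((Rep.free g).tgt_deg _).symm.trans ((congrArg N.V.tgt hd).trans
      ((φ.mixed.tgt_left u g hu).trans (A.obj.action.p_act _ _ _).symm))) hd
      ((φ.mixed.tgt_left u g hu).trans (A.obj.action.p_act _ _ _).symm)).symm.trans
    ((congrArg Subtype.val (A.braid_congr (Rep.free g) rfl he.symm _)).trans k)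
  refine ⟨(congrArg Prod.fst b).symm, ?_⟩
  refine Eq.trans ?_ (congrArg (fun z => z.2.1) b)
  exact N.H.comp_congr rfl (N.H.comp_one' _ _).symm _

/-- The second action and the second grading that a half-braiding determines on its object. -/
def toYetterDrinfeld : YetterDrinfeld φ where
  rep := A.obj
  act :=
    { act := A.vAct
      p_act := A.p_vAct
      act_act := fun f g e h₁ h₂ => (A.vAct_comp f g e h₁ h₂).1.symm
      one_act := fun e => A.vAct_one e _ }
  coact := A.coact
  tgt_coact := A.tgt_coact
  src_coact := A.src_coact
  coact_act g e h := by
    -- The third clause of `vAct_comp` for the product `g · 1`.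
    have k := (A.vAct_comp g (N.V.one (A.obj.p e)) e (h.trans (N.V.src_one _).symm)
      (N.V.tgt_one _)).2.2
    refine (N.right.congr ?_ rfl _).trans k
    exact (A.cocycle_eq g e h).symm.trans (A.cocycle_congr (N.V.comp_one' _ _).symm rfl h)
  deg_act g e h := by
    have k := Rep.Hom.map_deg (A.ζ (Rep.free g)).hom
      ⟨(Rep.freeGen g, e), A.q_freeGen_eq g e h⟩
    refine (M.V.comp_congr (φ.βcongr (Rep.deg_freeGen g).symm) rfl _).trans (k.symm.trans ?_)
    exact M.V.comp_congr rfl (φ.βcongr (N.left.congr (A.cocycle_eq g e h) rfl _)) _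
  act_comm u g e hu h := (A.vAct_comm u g e hu h).1
  coact_comm u e hu := by
    -- Equivariance at an identity arrow `g`, for which `g ▷ e = e`.
    have k := (A.vAct_comm u (N.V.one (A.obj.p e)) e (hu.trans (N.V.src_one _).symm)
      (N.V.tgt_one _)).2
    refine Eq.trans ?_ (k.trans ?_)
    · refine N.H.comp_congr ?_ rfl _
      refine (A.cocycle_one (A.obj.action.act u e hu)
        ((N.V.tgt_one (M.H.src u)).trans (A.obj.action.p_act _ _ _).symm)).symm.trans ?_
      exact A.cocycle_congr ((N.left_one' _ _).trans (congrArg N.V.one (φ.α.src_map u))).symm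
        (A.obj.action.congr ((M.right.congr rfl (φ.β.map_one _) _).trans
          (M.right.act_one' _ _)).symm rfl _) _
    · exact N.H.comp_congr (φ.αcongr (M.right.congr rfl (congrArg A.obj.deg (A.vAct_one e _)) _))
        rfl _

end Centralizer

/-! ### The equivalence -/

theorem Centralizer.braid_map {φ : MatchedPair.Hom M N} {A B : Centralizer φ.res} (f : A ⟶ B)
    (X : Rep N) (y : X.carrier) (e : A.obj.carrier) (h : X.q y = A.obj.p e)
    (h' : X.q y = B.obj.p (Rep.Hom.toFun f.hom e)) :
    (B.braid X y (Rep.Hom.toFun f.hom e) h').1 =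
      (Rep.Hom.toFun f.hom (A.braid X y e h).1.1, (A.braid X y e h).1.2) :=
  congrArg (fun k : Rep.tensorObj (φ.resObj X) A.obj ⟶ Rep.tensorObj B.obj (φ.resObj X) =>
    (Rep.Hom.toFun k ⟨(y, e), h⟩).1) (Centralizer.Hom.comm f X)

namespace MatchedPair.Hom

variable (φ : MatchedPair.Hom M N)

/-- The morphism of representations of `(𝕍, ℍ)` that underlies a morphism of representations of the
double. -/
def doubleResMap {E E' : Rep φ.double} (f : E ⟶ E') : φ.doubleRes E ⟶ φ.doubleRes E' where
  toFun := Rep.Hom.toFun (M := φ.double) f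
  p_map := Rep.Hom.p_map (M := φ.double) f
  q_map := Rep.Hom.q_map (M := φ.double) f
  map_act _ _ _ := Rep.Hom.map_act (M := φ.double) f _ _ _
  map_deg e := congrArg (fun v => v.1.1) (Rep.Hom.map_deg (M := φ.double) f e)

/-- The functor that sends a representation of the double to its half-braiding. -/
def doubleToCentralizer : Rep φ.double ⥤ Centralizer φ.res where
  obj E := (φ.ofDoubleRep E).toCentralizer
  map {E E'} f :=
    { hom := φ.doubleResMap f
      comm := fun X => Rep.hom_ext fun a => by
        obtain ⟨⟨y, e⟩, h⟩ := a
        have k := Rep.Hom.map_act (M := φ.double) f (φ.mixed.inV.toFun (X.deg y)) e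
          ((φ.mixed.inV.tgt_map _).trans ((X.tgt_deg y).trans h))
        refine Subtype.ext (Prod.ext k.symm (X.action.congr ?_ rfl _))
        exact (congrArg (fun e => (E'.deg e).1.2) k.symm).trans
          (congrArg (fun v => v.1.2) (Rep.Hom.map_deg (M := φ.double) f _)) }

/-- The functor that sends a half-braiding to the representation of the double it determines. -/
def centralizerToDouble : Centralizer φ.res ⥤ Rep φ.double where
  obj A := A.toYetterDrinfeld.toDoubleRep
  map {A B} f :=
    { toFun := Rep.Hom.toFun (M := M) f.hom
      p_map := Rep.Hom.p_map (M := M) f.hom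
      q_map := Rep.Hom.q_map (M := M) f.hom
      map_act := fun d e h => by
        refine (congrArg Prod.fst (Centralizer.braid_map f (Rep.free (N := N) d.1.1) (Rep.freeGen (N := N) d.1.1) _
          (A.q_freeGen_eq _ _ (d.2.trans (A.obj.action.p_act _ _ h).symm))
          (B.q_freeGen_eq _ _ (d.2.trans ((A.obj.action.p_act _ _ h).symm.trans
            (Rep.Hom.p_map (M := M) f.hom _).symm))))).symm.trans ?_
        exact B.vAct_congr rfl (Rep.Hom.map_act (M := M) f.hom _ _ _)
          (d.2.trans ((A.obj.action.p_act _ _ h).symm.trans (Rep.Hom.p_map (M := M) f.hom _).symm))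
      map_deg := fun e => by
        refine Subtype.ext (Prod.ext (Rep.Hom.map_deg (M := M) f.hom e) ?_)
        refine (B.cocycle_one _ ((N.V.tgt_one (A.obj.p e)).trans
          (Rep.Hom.p_map (M := M) f.hom e).symm)).symm.trans ?_
        exact congrArg (fun z => z.2.1) (Centralizer.braid_map f (Rep.free (N.V.one (A.obj.p e)))
          (Rep.freeGen _) e (A.q_freeGen_eq _ _ (N.V.tgt_one _))
          (B.q_freeGen_eq _ _ ((N.V.tgt_one _).trans (Rep.Hom.p_map (M := M) f.hom e).symm))) }

/-- Reassembling the parts of a representation of the double gives back that representation: an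
arrow `(g, h)` of `V ⋈ ℍ` is the product of `g` and `h`. -/
theorem centralizerToDouble_act (E : Rep φ.double) (d : φ.dH.Arr) (e : E.carrier)
    (h : φ.dH.tgt d = E.p e) :
    (φ.centralizerToDouble.obj (φ.doubleToCentralizer.obj E)).action.act d e h =
      E.action.act d e h := by
  obtain ⟨⟨g, u⟩, hd⟩ := d
  have hg : N.V.tgt g = E.p (E.action.act (φ.mixed.inH.toFun u) e h) :=
    hd.trans ((φ.mixed.inH.src_map u).symm.trans (E.action.p_act _ _ _).symm)
  refine (((φ.ofDoubleRep E).act.congr (Rep.deg_freeGen (N := N) g) rfl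
    ((congrArg N.V.tgt (Rep.deg_freeGen (N := N) g)).trans hg)).trans
    (E.action.act_act (φ.mixed.inV.toFun g) (φ.mixed.inH.toFun u) e
      ((φ.mixed.inV.tgt_map g).trans (hd.trans (φ.mixed.inH.src_map u).symm)) h)).trans ?_
  refine E.action.congr ?_ rfl _
  refine (φ.mixed.inV_comp (φ.mixed.inH.toFun u) g (hd.trans (φ.mixed.V.src_one _).symm)).trans ?_
  exact Subtype.ext (Prod.ext (N.V.comp_one' _ _) rfl)

/-- The `H`-grade recovered from the half-braiding is the product of `coact (1 ▷ e)` with the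
generator `1` of `free 1`. -/
theorem centralizerToDouble_deg (E : Rep φ.double) (e : E.carrier) :
    (φ.centralizerToDouble.obj (φ.doubleToCentralizer.obj E)).deg e = E.deg e := by
  refine Subtype.ext (Prod.ext rfl ?_)
  refine (N.H.comp_one' _ _).trans ?_
  exact congrArg (fun e => (E.deg e).1.2) (((φ.ofDoubleRep E).act.congr
    (Rep.deg_freeGen _) rfl _).trans ((φ.ofDoubleRep E).act.one_act' e (N.V.tgt_one _)))

/-- The half-braiding is recovered from the representation of the double it determines. -/
theorem doubleToCentralizer_braid (A : Centralizer φ.res) (X : Rep N) (y : X.carrier)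
    (e : A.obj.carrier) (h : X.q y = A.obj.p e) :
    (φ.doubleToCentralizer.obj (φ.centralizerToDouble.obj A)).braid X y e h = A.braid X y e h := by
  have hg : N.V.tgt (X.deg y) = A.obj.p e := (X.tgt_deg y).trans h
  have k : (φ.centralizerToDouble.obj A).action.act (φ.mixed.inV.toFun (X.deg y)) e
      ((φ.mixed.inV.tgt_map _).trans hg) = A.vAct (X.deg y) e hg :=
    A.vAct_congr rfl (A.obj.action.one_act' e _)
      (hg.trans ((A.obj.action.p_act _ _ ((M.H.tgt_one _).trans hg)).trans
        ((M.H.src_one _).trans hg)).symm)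
  refine Subtype.ext (Eq.trans ?_ (A.braid_eq X y e h rfl hg).symm)
  refine Prod.ext k (X.action.congr ?_ rfl _)
  exact (congrArg A.coact k).trans (A.cocycle_eq _ _ _).symm

/-- The action of `ℍ` on an object of the centralizer is recovered as well. -/
theorem doubleToCentralizer_act (A : Centralizer φ.res) (u : M.H.Arr) (e : A.obj.carrier)
    (h : M.H.tgt u = A.obj.p e) :
    (φ.doubleToCentralizer.obj (φ.centralizerToDouble.obj A)).obj.action.act u e h =
      A.obj.action.act u e h :=
  A.vAct_one _ ((N.V.tgt_one _).trans (A.obj.action.p_act u e h).symm)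

/-- The equivalence between representations of the double and the centralizer of restriction. Its
unit and counit are identities on underlying sets. -/
def doubleEquivalence : Rep φ.double ≌ Centralizer φ.res where
  functor := φ.doubleToCentralizer
  inverse := φ.centralizerToDouble
  unitIso := NatIso.ofComponents (fun E => Rep.isoOfInverse
    (F := φ.centralizerToDouble.obj (φ.doubleToCentralizer.obj E))
    { toFun := fun e => e
      p_map := fun _ => rfl
      q_map := fun _ => rfl
      map_act := fun d e h => (φ.centralizerToDouble_act E d e h).symm
      map_deg := φ.centralizerToDouble_deg E }
    (fun e => e) (fun _ => rfl) (fun _ => rfl)) (fun _ => rfl)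
  counitIso := NatIso.ofComponents (fun A => Centralizer.mkIso
    (A := φ.doubleToCentralizer.obj (φ.centralizerToDouble.obj A))
    (Rep.isoOfInverse
      { toFun := fun e => e
        p_map := fun _ => rfl
        q_map := fun _ => rfl
        map_act := φ.doubleToCentralizer_act A
        map_deg := fun _ => rfl }
      (fun e => e) (fun _ => rfl) (fun _ => rfl))
    (fun X => Rep.hom_ext fun a => (φ.doubleToCentralizer_braid A X a.1.1 a.1.2 a.2).symm))
    (fun _ => rfl)
  functor_unitIso_comp _ := rfl

/-! ### Strict monoidality -/

/-- The functor to the centralizer is monoidal, with structure morphisms that are identity maps. -/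
instance : φ.doubleToCentralizer.Monoidal :=
  Functor.CoreMonoidal.toMonoidal
    { εIso := Centralizer.mkIso (A := Centralizer.tensorUnit φ.res)
        (B := φ.doubleToCentralizer.obj (Rep.unit φ.double)) (Rep.isoOfInverse
          (E := Rep.unit M) (F := φ.doubleRes (Rep.unit φ.double))
          { toFun := fun e => e
            p_map := fun _ => rfl
            q_map := fun _ => rfl
            map_act := fun u _ _ => (N.V.src_one _).symm
            map_deg := fun _ => rfl }
          (fun e => e) (fun _ => rfl) (fun _ => rfl))
        (fun X => Rep.hom_ext fun a => by
          obtain ⟨⟨y, p⟩, h⟩ := a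
          refine Subtype.ext (Prod.ext (X.src_deg y) ?_)
          exact X.action.one_act' y _)
      μIso := fun E E' => Centralizer.mkIso
        (A := (φ.doubleToCentralizer.obj E).tensorObj (φ.doubleToCentralizer.obj E'))
        (B := φ.doubleToCentralizer.obj (Rep.tensorObj E E')) (Rep.isoOfInverse
          (E := Rep.tensorObj (φ.doubleRes E) (φ.doubleRes E'))
          (F := φ.doubleRes (Rep.tensorObj E E'))
          { toFun := fun a => a
            p_map := fun _ => rfl
            q_map := fun _ => rfl
            map_act := fun u a h => Subtype.ext (Prod.ext rfl
              (E'.action.congr (φ.dRight_inH u (E.deg a.1.1) (h.trans (E.src_deg _).symm)).symm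
                rfl _))
            map_deg := fun _ => rfl }
          (fun e => e) (fun _ => rfl) (fun _ => rfl))
        (fun X => Rep.hom_ext fun a => by
          obtain ⟨⟨y, ⟨⟨e, e'⟩, hee⟩⟩, h⟩ := a
          have hd : φ.dH.tgt (φ.mixed.inV.toFun (X.deg y)) = E.p e :=
            (φ.mixed.inV.tgt_map _).trans ((X.tgt_deg y).trans h)
          -- With `e'' = |y| ▷ e` and `x = coact e''`, both sides send `(y, (e, e'))` to
          -- `((e'', |x ▷ y| ▷ e'), coact (|x ▷ y| ▷ e') ▷ (x ▷ y))`.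
          have hx : N.H.tgt (E.deg (E.action.act (φ.mixed.inV.toFun (X.deg y)) e hd)).1.2 = X.p y :=
            (φ.ofDoubleRep E).tgt_coact_deg X y e ((X.tgt_deg y).trans h)
          have hg := (N.left.congr (congrArg (fun v => v.1.2) (E.deg_act _ e hd)).symm
            (rfl : X.deg y = _) (φ.tgt_actH _ _ _ _ (hd.trans (E.src_deg e).symm)
              (E.deg e).2.1 (E.deg e).2.2 (φ.mixed.inV.toFun (X.deg y)).2)).trans
            (X.deg_act (E.deg (E.action.act (φ.mixed.inV.toFun (X.deg y)) e hd)).1.2 y hx).symm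
          have k := E'.action.congr ((φ.dRight_inV (X.deg y) (E.deg e)
            (hd.trans (E.src_deg e).symm)).trans (congrArg φ.mixed.inV.toFun hg)) (rfl : e' = e')
            (((φ.isSquare _ _ _).c₄.trans (E.tgt_deg e)).trans hee)
          refine Subtype.ext (Prod.ext (Subtype.ext (Prod.ext rfl k)) ?_)
          refine (X.action.congr (N.H.comp_congr (congrArg (fun e => (E'.deg e).1.2) k) rfl _)
            rfl _).trans (X.action.act_act _ _ y ?_ hx).symm
          exact ((φ.ofDoubleRep E').tgt_coact_deg X (X.action.act _ y hx) e' ((X.tgt_deg _).trans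
            ((Rep.Hom.q_map ((φ.ofDoubleRep E).braiding X) ⟨(y, e), h⟩).trans hee))).trans
            (X.action.p_act _ _ _))
      μIso_hom_natural_left := fun _ _ => rfl
      μIso_hom_natural_right := fun _ _ => rfl
      associativity := fun _ _ _ => rfl
      left_unitality := fun _ => rfl
      right_unitality := fun _ => rfl }

noncomputable instance : φ.doubleEquivalence.functor.Monoidal :=
  inferInstanceAs φ.doubleToCentralizer.Monoidal

noncomputable instance : φ.doubleEquivalence.inverse.Monoidal :=
  φ.doubleEquivalence.inverseMonoidal

open Functor.LaxMonoidal

theorem isStrictMonoidal_functor : IsStrictMonoidal φ.doubleEquivalence.functor where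
  unit := Centralizer.exists_eq_eqToHom _ (Rep.exists_eq_eqToHom _ rfl HEq.rfl)
  tensor E E' := Centralizer.exists_eq_eqToHom _ (Rep.exists_eq_eqToHom _ rfl HEq.rfl)

/-- The structure morphisms of the inverse, which are composites of units, counits and structure
morphisms of the functor, are identity maps as well. -/
theorem isStrictMonoidal_inverse : IsStrictMonoidal φ.doubleEquivalence.inverse where
  unit := Rep.exists_eq_eqToHom _ rfl HEq.rfl
  tensor A B := Rep.exists_eq_eqToHom _ rfl HEq.rfl

end MatchedPair.Hom

end MatchedPairs

theorem theorem3 {P : Type u} {M N : MatchedPairs.MatchedPair P}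
    (φ : MatchedPairs.MatchedPair.Hom M N) :
    ∃ (e : MatchedPairs.Rep φ.double ≌ MatchedPairs.Centralizer φ.res)
      (_ : e.functor.Monoidal) (_ : e.inverse.Monoidal),
      e.IsMonoidal ∧
      MatchedPairs.IsStrictMonoidal e.functor ∧
      MatchedPairs.IsStrictMonoidal e.inverse ∧
      e.functor ⋙ MatchedPairs.Centralizer.forget φ.res ⋙ MatchedPairs.Rep.forget M =
        MatchedPairs.Rep.forget φ.double :=
  ⟨φ.doubleEquivalence, inferInstance, inferInstance,
    { leftAdjoint_ε := rfl, leftAdjoint_μ := fun _ _ => rfl },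
    φ.isStrictMonoidal_functor, φ.isStrictMonoidal_inverse, rfl⟩
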